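/- Let $\mathbb{K}$ be an arbitrary field, let $n$ be a non-negative integer, and let $M_n(\mathbb{K})$ be the vector space of all $n$ by $n$ matrices over $\mathbb{K}$. Let $N \in M_n(\mathbb{K})$ be a singular matrix (of any rank less than $n$, possibly $N=0$), with kernel $\operatorname{Ker} N = \{X \in \mathbb{K}^n : NX=0\}$ and image $\operatorname{Im} N = \{NX : X \in \mathbb{K}^n\}$. Let $\mathcal{S}$ be an affine subspace of $M_n(\mathbb{K})$ such that $\operatorname{codim} \mathcal{S} \leq n-2$, where $\operatorname{codim} \mathcal{S}$ is the codimension in $M_n(\mathbb{K})$ of the translation vector space of $\mathcal{S}$. Assume that there exists $M \in \mathcal{S}$ such that the linear map $X \in \operatorname{Ker} N \mapsto \overline{MX} \in \mathbb{K}^n/\operatorname{Im} N$, where $\overline{Y}$ denotes the class of $Y$ modulo $\operatorname{Im} N$, is not injective. Then there exists $A \in \mathcal{S}$ such that every matrix of $A+\mathbb{K}N = \{A+tN : t \in \mathbb{K}\}$ is invertible. -/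

import Mathlib

/-- The codimension of an affine subspace of a vector space: the dimension of the quotient of the
ambient vector space by the direction (translation vector space) of the affine subspace. -/
noncomputable def affineCodim {K V : Type*} [Field K] [AddCommGroup V] [Module K V]
    (S : AffineSubspace K V) : ℕ :=
  Module.finrank K (V ⧸ S.direction)

/-- The operator `Ker N → K^n / Im N` that is induced by a square matrix `M`: it sends a vector
`X` of the kernel of `N` to the class of `M X` modulo the column space of `N`. -/
def inducedOperator {K : Type*} [Field K] {n : ℕ} (N M : Matrix (Fin n) (Fin n) K) :
    LinearMap.ker N.mulVecLin →ₗ[K] (Fin n → K) ⧸ LinearMap.range N.mulVecLin :=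
  (LinearMap.range N.mulVecLin).mkQ ∘ₗ M.mulVecLin ∘ₗ (LinearMap.ker N.mulVecLin).subtype

open Module LinearMap

universe u v w

/-! ### Dimension counts and functionals in linear algebra -/

section Basics

variable {K : Type*} {U V : Type*} [Field K] [AddCommGroup U] [Module K U] [AddCommGroup V] [Module K V]

/-! The affine space is written as the set of operators `A : U → V` that agree with `M` under the
functionals `tr (R ·)`, for `R` in a space `W` of maps `V → U` with `dim W ≤ n - 2`. The proof is a
strong induction on `n`. If `X ⊆ Ker N` and `M` is injective on `X`, then `N` and `M` pass to `U/X →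
V/M(X)`. A solution there lifts to a block-triangular one, because `A + tN` coincides with `M` on
`X` (`HasInvertibleLine.of_quotient`). Only those `R ∈ W` with `R(M X) ⊆ X` constrain the quotient,
and those with range in `X` constrain nothing. The difficulty is to choose `M` and `X` so that the
number of conditions drops enough and the induced operator of the quotient is still singular.

If `dim Ker N ≥ 2` and some admissible operator is singular but nonzero from `Ker N` to `V / Im N`,
one vector can be split off (`exists_reducible_operator`). If every singular induced operator is
zero, then `W` contains many conditions on the induced operator alone (`le_finrank_inf_rangeKer`),
and all of `Ker N` can be split off at once (`HasInvertibleLine.of_induced_eq_zero`).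

If `dim Ker N = 1`, one vector again suffices unless all conditions involve only `M x` and `φ ∘ M`,
where `Im N = ker φ`. The remaining freedom then allows a direct construction, with a special one
for `n = 3` over the field with two elements. -/

theorem finrank_map_add_finrank_inf_ker [FiniteDimensional K U] (f : U →ₗ[K] V)
    (W : Submodule K U) : finrank K (W.map f) + finrank K ↥(W ⊓ ker f) = finrank K W := by
  have h := LinearMap.finrank_range_add_finrank_ker (f.domRestrict W)
  rw [LinearMap.range_domRestrict, LinearMap.ker_domRestrict] at h
  rw [← h, ← Submodule.map_comap_subtype, Submodule.finrank_map_subtype_eq]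

theorem finrank_map_add_le [FiniteDimensional K U] (f : U →ₗ[K] V) {W W₀ : Submodule K U}
    (h : W₀ ≤ W) (h₀ : ∀ w ∈ W₀, f w = 0) :
    finrank K (W.map f) + finrank K W₀ ≤ finrank K W := by
  rw [← finrank_map_add_finrank_inf_ker f W]
  gcongr
  exact Submodule.finrank_mono (le_inf h fun w hw => h₀ w hw)

theorem exists_mem_notMem_notMem {Y A B : Submodule K U} (hA : ¬ Y ≤ A) (hB : ¬ Y ≤ B) :
    ∃ y ∈ Y, y ∉ A ∧ y ∉ B := by
  obtain ⟨a, ha, haA⟩ := SetLike.not_le_iff_exists.1 hA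
  obtain ⟨b, hb, hbB⟩ := SetLike.not_le_iff_exists.1 hB
  by_cases haB : a ∈ B
  · by_cases hbA : b ∈ A
    · refine ⟨a + b, Y.add_mem ha hb, fun h => haA ?_, fun h => hbB ?_⟩
      · simpa using A.sub_mem h hbA
      · simpa using B.sub_mem h haB
    · exact ⟨b, hb, hbA, hbB⟩
  · exact ⟨a, ha, haA, haB⟩

theorem exists_dual_eq_one {p : Submodule K U} {x : U} (hx : x ∉ p) :
    ∃ f : U →ₗ[K] K, f x = 1 ∧ ∀ y ∈ p, f y = 0 := by
  obtain ⟨f, hf, hp⟩ := Submodule.exists_le_ker_of_notMem hx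
  exact ⟨(f x)⁻¹ • f, by simp [hf], fun y hy => by simp [LinearMap.mem_ker.1 (hp hy)]⟩

theorem exists_dual_eq_one_of_ne_zero {x : U} (hx : x ≠ 0) : ∃ f : U →ₗ[K] K, f x = 1 := by
  obtain ⟨f, hf, -⟩ := exists_dual_eq_one (K := K) (p := ⊥) (x := x) (by simpa using hx)
  exact ⟨f, hf⟩

theorem notMem_span_singleton_symm {x u : U} (hu : u ≠ 0) (hx : x ∉ Submodule.span K {u}) :
    u ∉ Submodule.span K {x} := by
  intro h
  obtain ⟨a, rfl⟩ := Submodule.mem_span_singleton.1 h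
  have ha : a ≠ 0 := fun h => hu (by simp [h])
  exact hx (Submodule.mem_span_singleton.2 ⟨a⁻¹, by rw [smul_smul, inv_mul_cancel₀ ha, one_smul]⟩)

theorem exists_apply_eq_apply_eq_zero {x u : U} (hx : x ∉ Submodule.span K {u}) (y : V) :
    ∃ M : U →ₗ[K] V, M x = y ∧ M u = 0 := by
  obtain ⟨f, hf, hu⟩ := exists_dual_eq_one hx
  exact ⟨f.smulRight y, by simp [hf], by simp [hu u (Submodule.mem_span_singleton_self u)]⟩

theorem finrank_span_singleton_le_one (x : U) : finrank K (Submodule.span K {x}) ≤ 1 := by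
  simpa using finrank_span_le_card (R := K) ({x} : Set U)

theorem exists_mem_notMem_span_singleton [FiniteDimensional K U] {X : Submodule K U} (x : U)
    (h : 2 ≤ finrank K X) : ∃ u ∈ X, u ∉ Submodule.span K {x} := by
  by_contra! hc
  have := (Submodule.finrank_mono (R := K) (show X ≤ _ from hc)).trans (finrank_span_singleton_le_one x)
  omega

end Basics

/-! ### Trace duality: affine spaces of operators as systems of trace conditions -/

section Trace

variable {K : Type*} {U V : Type*} [Field K] [AddCommGroup U] [Module K U] [AddCommGroup V]
  [Module K V]

/-- The linear maps from `V` to `U` with range in `X` that vanish on `Y`. -/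
def rangeKer (X : Submodule K U) (Y : Submodule K V) : Submodule K (V →ₗ[K] U) where
  carrier := {R | (∀ v, R v ∈ X) ∧ ∀ y ∈ Y, R y = 0}
  add_mem' := fun ha hb => ⟨fun v => X.add_mem (ha.1 v) (hb.1 v), fun y hy => by
    simp [ha.2 y hy, hb.2 y hy]⟩
  zero_mem' := ⟨fun v => X.zero_mem, fun y _ => rfl⟩
  smul_mem' := fun c _ ha => ⟨fun v => X.smul_mem c (ha.1 v), fun y hy => by simp [ha.2 y hy]⟩

theorem mem_rangeKer {X : Submodule K U} {Y : Submodule K V} {R : V →ₗ[K] U} :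
    R ∈ rangeKer X Y ↔ (∀ v, R v ∈ X) ∧ ∀ y ∈ Y, R y = 0 := Iff.rfl

theorem mem_rangeKer_bot {X : Submodule K U} {R : V →ₗ[K] U} :
    R ∈ rangeKer X ⊥ ↔ ∀ v, R v ∈ X := by
  simp [mem_rangeKer]

theorem finrank_rangeKer [FiniteDimensional K U] [FiniteDimensional K V] (X : Submodule K U)
    (Y : Submodule K V) : finrank K (rangeKer X Y) = finrank K (V ⧸ Y) * finrank K X := by
  rw [← Module.finrank_linearMap K K (V ⧸ Y) X]
  refine LinearEquiv.finrank_eq (LinearEquiv.symm ?_)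
  let g : ((V ⧸ Y) →ₗ[K] X) →ₗ[K] (V →ₗ[K] U) :=
    { toFun := fun f => X.subtype ∘ₗ f ∘ₗ Y.mkQ
      map_add' := fun _ _ => by ext; simp
      map_smul' := fun _ _ => by ext; simp }
  have hg : Function.Injective g := by
    intro a b hab
    ext v
    simpa [g] using LinearMap.congr_fun hab v
  have hr : range g = rangeKer X Y := by
    ext R
    constructor
    · rintro ⟨f, rfl⟩
      exact ⟨fun v => by simp [g], fun y hy => by simp [g, (Submodule.Quotient.mk_eq_zero Y).2 hy]⟩
    · intro hR
      exact ⟨Y.liftQ (R.codRestrict X hR.1) fun y hy => by ext; simpa using hR.2 y hy, by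
        ext v; exact rfl⟩
  exact (LinearEquiv.ofInjective g hg).trans (LinearEquiv.ofEq _ _ hr)

/-- The composite squares to zero: it lands in `X`, which `P` sends into `Y`, which `R` kills. With
the converse below, `rangeKer X Y` is the space of conditions that see exactly the map `X → V / Y`
induced by an operator. -/
theorem trace_comp_eq_zero_of_mem_rangeKer [FiniteDimensional K U] {X : Submodule K U}
    {Y : Submodule K V} {R : V →ₗ[K] U} (hR : R ∈ rangeKer X Y) {P : U →ₗ[K] V}
    (hP : ∀ x ∈ X, P x ∈ Y) : trace K U (R ∘ₗ P) = 0 := by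
  refine (LinearMap.isNilpotent_trace_of_isNilpotent ⟨2, ?_⟩).eq_zero
  ext u
  simp [pow_two, hR.2 _ (hP _ (hR.1 (P u)))]

theorem trace_comp_smulRight [FiniteDimensional K U] (R : V →ₗ[K] U) (f : U →ₗ[K] K) (y : V) :
    trace K U (R ∘ₗ f.smulRight y) = f (R y) := by
  rw [show R ∘ₗ f.smulRight y = f.smulRight (R y) by ext; simp, trace_smulRight]

theorem trace_comp_of_mem_span_singleton [FiniteDimensional K U] {R : V →ₗ[K] U} {x : U}
    (hR : ∀ v, R v ∈ Submodule.span K {x}) {f : U →ₗ[K] K} (hf : f x = 1) (M : U →ₗ[K] V) :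
    trace K U (R ∘ₗ M) = f (R (M x)) := by
  rw [show R ∘ₗ M = (f ∘ₗ R ∘ₗ M).smulRight x from ?_, trace_smulRight]
  · rfl
  · ext u
    obtain ⟨c, hc⟩ := Submodule.mem_span_singleton.1 (hR (M u))
    simp [← hc, hf]

theorem map_mem_of_trace_comp_eq_zero [FiniteDimensional K U] {X : Submodule K U}
    {Y : Submodule K V} {P : U →ₗ[K] V} (h : ∀ R ∈ rangeKer X Y, trace K U (R ∘ₗ P) = 0) :
    ∀ x ∈ X, P x ∈ Y := by
  intro x hx
  by_contra hy
  obtain ⟨f, hf, hfY⟩ := exists_dual_eq_one hy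
  have := h (f.smulRight x) ⟨fun v => X.smul_mem _ hx, fun y hy => by simp [hfY y hy]⟩
  rw [show f.smulRight x ∘ₗ P = (f ∘ₗ P).smulRight x by ext; simp, trace_smulRight] at this
  simp [hf] at this

/-- `A` and `B` take the same values under all the functionals `M ↦ tr (R M)`, `R ∈ W`. -/
def TraceAgree (W : Submodule K (V →ₗ[K] U)) (A B : U →ₗ[K] V) : Prop :=
  ∀ R ∈ W, trace K U (R ∘ₗ A) = trace K U (R ∘ₗ B)

theorem TraceAgree.symm {W : Submodule K (V →ₗ[K] U)} {A B : U →ₗ[K] V} (h : TraceAgree W A B) :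
    TraceAgree W B A := fun R hR => (h R hR).symm

theorem TraceAgree.trans {W : Submodule K (V →ₗ[K] U)} {A B C : U →ₗ[K] V}
    (h : TraceAgree W A B) (h' : TraceAgree W B C) : TraceAgree W A C :=
  fun R hR => (h R hR).trans (h' R hR)

theorem traceAgree_iff_sub {W : Submodule K (V →ₗ[K] U)} {A B : U →ₗ[K] V} :
    TraceAgree W A B ↔ ∀ R ∈ W, trace K U (R ∘ₗ (A - B)) = 0 := by
  simp only [TraceAgree, LinearMap.comp_sub, map_sub, sub_eq_zero]

theorem TraceAgree.mono {W W' : Submodule K (V →ₗ[K] U)} {A B : U →ₗ[K] V} (h : TraceAgree W A B)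
    (hW : W' ≤ W) : TraceAgree W' A B := fun R hR => h R (hW hR)

theorem traceAgree_rangeKer_iff [FiniteDimensional K U] {X : Submodule K U} {Y : Submodule K V} {A B : U →ₗ[K] V} :
    TraceAgree (rangeKer X Y) A B ↔ ∀ x ∈ X, A x - B x ∈ Y := by
  rw [traceAgree_iff_sub]
  exact ⟨fun h => map_mem_of_trace_comp_eq_zero h,
    fun h R hR => trace_comp_eq_zero_of_mem_rangeKer hR h⟩

/-- The trace pairing between linear maps from `U` to `V` and linear maps from `V` to `U`. -/
noncomputable def traceDual : (U →ₗ[K] V) →ₗ[K] Dual K (V →ₗ[K] U) :=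
  LinearMap.mk₂ K (fun P R => trace K U (R ∘ₗ P)) (fun _ _ _ => by simp [LinearMap.comp_add])
    (fun _ _ _ => by simp [LinearMap.comp_smul]) (fun _ _ _ => by simp [LinearMap.add_comp])
    (fun _ _ _ => by simp [LinearMap.smul_comp])

theorem traceDual_injective [FiniteDimensional K U] :
    Function.Injective (traceDual : (U →ₗ[K] V) →ₗ[K] Dual K (V →ₗ[K] U)) := by
  rw [injective_iff_map_eq_zero]
  intro P hP
  ext x
  simpa using map_mem_of_trace_comp_eq_zero (X := ⊤) (Y := ⊥) (P := P)
    (fun R _ => LinearMap.congr_fun hP R) x trivial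

variable [FiniteDimensional K U] [FiniteDimensional K V]

theorem exists_trace_comp_eq (f : (V →ₗ[K] U) →ₗ[K] K) :
    ∃ P : U →ₗ[K] V, ∀ R, f R = trace K U (R ∘ₗ P) := by
  have hd : finrank K (U →ₗ[K] V) = finrank K (Dual K (V →ₗ[K] U)) := by
    rw [Subspace.dual_finrank_eq, Module.finrank_linearMap, Module.finrank_linearMap, mul_comm]
  obtain ⟨P, hP⟩ :=
    (LinearMap.injective_iff_surjective_of_finrank_eq_finrank hd).1 traceDual_injective f
  exact ⟨P, fun R => by rw [← hP]; rfl⟩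

/-- Every space of linear maps is defined by as many trace conditions as its codimension. -/
theorem exists_submodule_trace_conditions (D : Submodule K (U →ₗ[K] V)) :
    ∃ W : Submodule K (V →ₗ[K] U), finrank K W ≤ finrank K ((U →ₗ[K] V) ⧸ D) ∧
      ∀ P, (∀ R ∈ W, trace K U (R ∘ₗ P) = 0) → P ∈ D := by
  refine ⟨D.dualAnnihilator.comap traceDual, ?_, fun P hP => ?_⟩
  · have h := finrank_map_add_finrank_inf_ker traceDual (D.dualAnnihilator.comap
      (traceDual : (V →ₗ[K] U) →ₗ[K] Dual K (U →ₗ[K] V)))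
    rw [LinearMap.ker_eq_bot.2 traceDual_injective, inf_bot_eq, finrank_bot] at h
    have h1 := Submodule.finrank_mono (Submodule.map_comap_le
      (traceDual : (V →ₗ[K] U) →ₗ[K] Dual K (U →ₗ[K] V)) D.dualAnnihilator)
    have h2 := Subspace.finrank_add_finrank_dualAnnihilator_eq D
    have h3 := Submodule.finrank_quotient_add_finrank D
    omega
  · rw [← Subspace.forall_mem_dualAnnihilator_apply_eq_zero_iff]
    intro f hf
    obtain ⟨R, hR⟩ := exists_trace_comp_eq f
    rw [hR, LinearMap.trace_comp_comm']
    refine hP R ?_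
    rw [Submodule.mem_comap, show traceDual R = f from LinearMap.ext fun P => (hR P).symm]
    exact hf

theorem le_sup_of_trace_comp {A B C : Submodule K (V →ₗ[K] U)}
    (h : ∀ P : U →ₗ[K] V, (∀ R ∈ A, trace K U (R ∘ₗ P) = 0) →
      (∀ R ∈ B, trace K U (R ∘ₗ P) = 0) → ∀ R ∈ C, trace K U (R ∘ₗ P) = 0) : C ≤ A ⊔ B := by
  rw [← Subspace.dualAnnihilator_le_dualAnnihilator_iff]
  intro f hf
  rw [Submodule.mem_dualAnnihilator] at hf ⊢
  obtain ⟨P, hP⟩ := exists_trace_comp_eq f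
  simp only [hP] at hf ⊢
  exact h P (fun R hR => hf R (Submodule.mem_sup_left hR))
    (fun R hR => hf R (Submodule.mem_sup_right hR))

/-- Two compatible systems of trace conditions can be satisfied simultaneously. -/
theorem exists_traceAgree {W Q : Submodule K (V →ₗ[K] U)} {A B : U →ₗ[K] V}
    (h : TraceAgree (W ⊓ Q) A B) : ∃ M, TraceAgree W M A ∧ TraceAgree Q M B := by
  have hmem : ((trace K U) ∘ₗ (LinearMap.lcomp K U (A - B)) : Dual K (V →ₗ[K] U)) ∈
      (W ⊓ Q).dualAnnihilator := by
    rw [Submodule.mem_dualAnnihilator]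
    exact traceAgree_iff_sub.1 h
  -- The annihilator of an intersection is the sum of the annihilators, so `A - B` splits into a
  -- part invisible to `W` and a part invisible to `Q`.
  rw [Subspace.dualAnnihilator_inf_eq] at hmem
  obtain ⟨f, hf, g, hg, hfg⟩ := Submodule.mem_sup.1 hmem
  rw [Submodule.mem_dualAnnihilator] at hf hg
  obtain ⟨P, hP⟩ := exists_trace_comp_eq f
  refine ⟨A - P, fun R hR => ?_, fun R hR => ?_⟩
  · rw [LinearMap.comp_sub, map_sub, ← hP, hf R hR, sub_zero]
  · have := LinearMap.congr_fun hfg R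
    simp only [LinearMap.add_apply, hg R hR, add_zero, hP, LinearMap.comp_apply,
      LinearMap.lcomp_apply', LinearMap.comp_sub, map_sub] at this
    rw [LinearMap.comp_sub, map_sub, this]
    ring

/-- `D` is cut out of `Y` by the functionals `f ∘ R`, `R ∈ A₁`. Those coming from `A₀` vanish on
`Y`, so at most `dim A₁ - dim A₀` of them are independent. Moving `M x` by `w ∈ D`, where `f x = 1`,
then respects the conditions in `A₁`. -/
theorem exists_submodule_dual_apply_eq_zero (f : U →ₗ[K] K) (Y : Submodule K V)
    {A₀ A₁ : Submodule K (V →ₗ[K] U)} (hA : A₀ ≤ A₁) (h₀ : ∀ R ∈ A₀, ∀ y ∈ Y, f (R y) = 0) :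
    ∃ D ≤ Y, (∀ w ∈ D, ∀ R ∈ A₁, f (R w) = 0) ∧
      finrank K Y + finrank K A₀ ≤ finrank K D + finrank K A₁ := by
  let g : (V →ₗ[K] U) →ₗ[K] Dual K Y :=
    { toFun := fun R => f ∘ₗ R ∘ₗ Y.subtype
      map_add' := fun _ _ => by ext; simp
      map_smul' := fun _ _ => by ext; simp }
  have h1 := finrank_map_add_le g hA fun R hR => by ext y; exact h₀ R hR y y.2
  have h2 := Subspace.finrank_add_finrank_dualCoannihilator_eq (A₁.map g)
  refine ⟨(A₁.map g).dualCoannihilator.map Y.subtype, Submodule.map_subtype_le _ _, ?_, ?_⟩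
  · rintro _ ⟨w, hw, rfl⟩ R hR
    exact (Submodule.mem_dualCoannihilator _).1 hw (g R) (Submodule.mem_map_of_mem hR)
  · rw [Submodule.finrank_map_subtype_eq]
    omega

end Trace

/-! ### The unconstrained case and reduction to quotient spaces -/

section Quotient

variable {K : Type w} {U : Type u} {V : Type v} [Field K] [AddCommGroup U] [Module K U]
  [AddCommGroup V] [Module K V] [FiniteDimensional K U] [FiniteDimensional K V]

/-- The singularity criterion in dimension `n`: for affine spaces of codimension at most `n - 2`,
one operator inducing a non-injective map on `Ker N → V / Im N` yields a line of invertible ones. -/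
def HasInvertibleLine (K : Type w) [Field K] (n : ℕ) : Prop :=
  ∀ (U : Type u) (V : Type v) [AddCommGroup U] [Module K U] [AddCommGroup V] [Module K V]
    [FiniteDimensional K U] [FiniteDimensional K V] (_ : finrank K U = n) (_ : finrank K V = n)
    (N M : U →ₗ[K] V) (W : Submodule K (V →ₗ[K] U)) (x : U),
    finrank K W + 2 ≤ n → x ≠ 0 → N x = 0 → M x ∈ range N →
    ∃ A, TraceAgree W A M ∧ ∀ t : K, Function.Injective (A + t • N)

theorem exists_mkQ_comp_eq_id (Y : Submodule K V) : ∃ s : V ⧸ Y →ₗ[K] V, ∀ v, Y.mkQ (s v) = v := by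
  obtain ⟨s, hs⟩ := Y.mkQ.exists_rightInverse_of_surjective (by simp)
  exact ⟨s, LinearMap.congr_fun hs⟩

/-- Send `x` to some `N z ≠ 0` and pass to the quotients by `x` and `N z`: there `N` kills the
nonzero class of `z`, so induction applies. In a suitable basis `N` becomes strictly triangular
against an invertible triangular `A`. -/
theorem exists_forall_injective_add_smul (n : ℕ) :
    ∀ (U : Type u) (V : Type v) [AddCommGroup U] [Module K U] [AddCommGroup V] [Module K V]
    [FiniteDimensional K U] [FiniteDimensional K V] (_ : finrank K U = n) (_ : finrank K V = n)
    (N : U →ₗ[K] V) (x : U), x ≠ 0 → N x = 0 →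
    ∃ A : U →ₗ[K] V, ∀ t : K, Function.Injective (A + t • N) := by
  induction n with
  | zero =>
    intro U V _ _ _ _ _ _ hU _ N x hx
    exact absurd (finrank_zero_iff_forall_zero.1 hU x) hx
  | succ n ih =>
    intro U V _ _ _ _ _ _ hU hV N x hx hNx
    by_cases hN : N = 0
    · exact ⟨LinearEquiv.ofFinrankEq U V (hU.trans hV.symm), fun t => by
        simpa [hN] using LinearEquiv.injective _⟩
    obtain ⟨z, hz⟩ : ∃ z, N z ≠ 0 := by
      by_contra! h
      exact hN (LinearMap.ext h)
    have hle : Submodule.span K {x} ≤ (Submodule.span K {N z}).comap N := by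
      rw [Submodule.span_singleton_le_iff_mem, Submodule.mem_comap, hNx]
      exact Submodule.zero_mem _
    have hU' := Submodule.finrank_quotient_add_finrank (Submodule.span K {x})
    have hV' := Submodule.finrank_quotient_add_finrank (Submodule.span K {N z})
    rw [finrank_span_singleton hx, hU] at hU'
    rw [finrank_span_singleton hz, hV] at hV'
    obtain ⟨A', hA'⟩ := ih (U ⧸ Submodule.span K {x}) (V ⧸ Submodule.span K {N z}) (by omega)
      (by omega) (Submodule.mapQ _ _ N hle) (Submodule.Quotient.mk z)
      (by
        rw [Ne, Submodule.Quotient.mk_eq_zero, Submodule.mem_span_singleton]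
        rintro ⟨a, rfl⟩
        simp [hNx] at hz)
      (by
        rw [Submodule.mapQ_apply, Submodule.Quotient.mk_eq_zero]
        exact Submodule.mem_span_singleton_self _)
    obtain ⟨s, hs⟩ := exists_mkQ_comp_eq_id (Submodule.span K {N z})
    obtain ⟨f, hf⟩ := exists_dual_eq_one_of_ne_zero (K := K) hx
    refine ⟨s ∘ₗ A' ∘ₗ Submodule.mkQ _ + f.smulRight (N z), fun t => ?_⟩
    rw [injective_iff_map_eq_zero]
    intro a ha
    have h0 : (A' + t • Submodule.mapQ _ _ N hle) (Submodule.Quotient.mk a) = 0 := by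
      have := congrArg (Submodule.span K {N z}).mkQ ha
      simp only [LinearMap.add_apply, LinearMap.comp_apply, map_add, hs, LinearMap.smulRight_apply,
        LinearMap.smul_apply, map_smul, map_zero] at this
      have hq : (Submodule.span K {N z}).mkQ (N z) = 0 :=
        (Submodule.Quotient.mk_eq_zero _).2 (Submodule.mem_span_singleton_self _)
      rw [hq, smul_zero, add_zero] at this
      exact this
    have h1 := (injective_iff_map_eq_zero _).1 (hA' t) _ h0
    rw [Submodule.Quotient.mk_eq_zero, Submodule.mem_span_singleton] at h1
    obtain ⟨c, rfl⟩ := h1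
    have h2 : (Submodule.span K {x}).mkQ x = 0 := by simp
    simp only [LinearMap.add_apply, LinearMap.comp_apply, map_smul, h2, LinearMap.smulRight_apply,
      LinearMap.smul_apply, hNx, hf] at ha
    have hc : c = 0 := by simpa [hz] using ha
    simp [hc]

/-- Reduction of the problem modulo a subspace `X` of `Ker N` on which `M` is injective. -/
theorem HasInvertibleLine.of_quotient {m : ℕ} (ih : HasInvertibleLine.{u, v} K m)
    (N M : U →ₗ[K] V) (W : Submodule K (V →ₗ[K] U)) (X : Submodule K U)
    (hU : finrank K U = m + finrank K X) (hV : finrank K V = m + finrank K X)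
    (hNX : ∀ x ∈ X, N x = 0) (hMX : ∀ x ∈ X, M x = 0 → x = 0)
    (hW : finrank K ↥(W ⊓ Submodule.compatibleMaps (X.map M) X) + 2 ≤
      m + finrank K ↥(W ⊓ rangeKer X ⊥))
    {z : U} (hz : z ∉ X) (hNz : N z ∈ X.map M) (hMz : M z ∈ range N ⊔ X.map M) :
    ∃ A, TraceAgree W A M ∧ ∀ t : K, Function.Injective (A + t • N) := by
  obtain ⟨Y, hY⟩ : ∃ Y, Y = X.map M := ⟨_, rfl⟩
  rw [← hY] at hW hNz hMz
  have hfY : finrank K Y = finrank K X := by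
    have h := finrank_map_add_finrank_inf_ker M X
    rw [show X ⊓ ker M = ⊥ from (Submodule.eq_bot_iff _).2 fun x hx => hMX x hx.1 hx.2,
      finrank_bot] at h
    rw [hY, ← h, add_zero]
  have hMXY : X ≤ Y.comap M := by rw [hY]; exact Submodule.le_comap_map M X
  have hNXY : X ≤ Y.comap N := fun x hx => by simp [hNX x hx]
  have hU' := Submodule.finrank_quotient_add_finrank X
  have hV' := Submodule.finrank_quotient_add_finrank Y
  obtain ⟨s, hs⟩ := exists_mkQ_comp_eq_id Y
  let θ : (V →ₗ[K] U) →ₗ[K] (V ⧸ Y →ₗ[K] U ⧸ X) :=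
    { toFun := fun R => X.mkQ ∘ₗ R ∘ₗ s
      map_add' := fun _ _ => by ext; simp
      map_smul' := fun _ _ => by ext; simp }
  have hθ : ∀ R ∈ Submodule.compatibleMaps Y X, ∀ v, θ R (Y.mkQ v) = X.mkQ (R v) := by
    intro R hR v
    have h : s (Y.mkQ v) - v ∈ Y := by
      rw [← Submodule.Quotient.mk_eq_zero, Submodule.Quotient.mk_sub, sub_eq_zero]
      exact hs _
    have h' := (Submodule.Quotient.mk_eq_zero X).2 (hR h)
    rw [map_sub, Submodule.Quotient.mk_sub, sub_eq_zero] at h'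
    exact h'
  -- Only maps with `R(Y) ⊆ X` descend to the quotients, and those with range in `X` descend to
  -- zero; this is the gain in the count of conditions.
  let W' := (W ⊓ Submodule.compatibleMaps Y X).map θ
  have hW' : finrank K W' + finrank K ↥(W ⊓ rangeKer X ⊥) ≤
      finrank K ↥(W ⊓ Submodule.compatibleMaps Y X) := by
    refine finrank_map_add_le θ (fun R hR => ⟨hR.1, fun y _ => hR.2.1 y⟩) fun R hR => ?_
    ext v
    simpa [θ] using (Submodule.Quotient.mk_eq_zero X).2 (hR.2.1 (s (Y.mkQ v)))
  obtain ⟨A', hA', hinj⟩ := ih (U ⧸ X) (V ⧸ Y) (by omega) (by omega) (X.mapQ Y N hNXY)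
    (X.mapQ Y M hMXY) W' (X.mkQ z) (by omega)
    (by rwa [Submodule.mkQ_apply, Ne, Submodule.Quotient.mk_eq_zero])
    (by rwa [Submodule.mkQ_apply, Submodule.mapQ_apply, Submodule.Quotient.mk_eq_zero])
    (by
      obtain ⟨_, ⟨a, rfl⟩, y, hy, h⟩ := Submodule.mem_sup.1 hMz
      refine ⟨X.mkQ a, ?_⟩
      rw [Submodule.mkQ_apply, Submodule.mkQ_apply, Submodule.mapQ_apply, Submodule.mapQ_apply, ← h,
        Submodule.Quotient.mk_add, (Submodule.Quotient.mk_eq_zero Y).2 hy, add_zero])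
  -- lift the difference of `A'` and the induced operator
  let P₁ : U →ₗ[K] V := s ∘ₗ (A' - X.mapQ Y M hMXY) ∘ₗ X.mkQ
  have hP₁ : ∀ R ∈ W ⊓ Submodule.compatibleMaps Y X, trace K U (R ∘ₗ P₁) = 0 := by
    intro R hR
    have h := (traceAgree_iff_sub.1 hA') (θ R) (Submodule.mem_map_of_mem hR)
    rw [← h, show R ∘ₗ P₁ = (R ∘ₗ s ∘ₗ (A' - X.mapQ Y M hMXY)) ∘ₗ X.mkQ from rfl,
      LinearMap.trace_comp_comm']
    rfl
  -- Agreement on `compatibleMaps Y X` fixes `P` on `X` and modulo `Y`. The maps `U/X → Y` remain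
  -- free and absorb the other conditions of `W`.
  obtain ⟨P, hPW, hPQ⟩ := exists_traceAgree (W := W) (Q := Submodule.compatibleMaps Y X)
    (A := 0) (B := P₁) fun R hR => by rw [hP₁ R hR]; simp
  have hPX : ∀ a ∈ X, P a = 0 := by
    intro a ha
    have h := traceAgree_rangeKer_iff.1 (hPQ.mono (W' := rangeKer X ⊥)
      fun R hR y _ => hR.1 y) a ha
    rw [Submodule.mem_bot, sub_eq_zero] at h
    rw [h]
    have h0 : X.mkQ a = 0 := (Submodule.Quotient.mk_eq_zero X).2 ha
    simp only [P₁, LinearMap.comp_apply, h0, map_zero]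
  have hPP : ∀ a, Y.mkQ (P a) = (A' - X.mapQ Y M hMXY) (X.mkQ a) := by
    intro a
    have h := traceAgree_rangeKer_iff.1 (hPQ.mono (W' := rangeKer ⊤ Y)
      fun R hR y hy => by simp [hR.2 y hy]) a trivial
    rw [← Submodule.Quotient.mk_eq_zero, Submodule.Quotient.mk_sub, sub_eq_zero] at h
    exact h.trans (hs _)
  refine ⟨M + P, traceAgree_iff_sub.2 fun R hR => ?_, fun t => ?_⟩
  · rw [add_sub_cancel_left, hPW R hR]
    simp
  · rw [injective_iff_map_eq_zero]
    intro a ha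
    have h0 : (A' + t • X.mapQ Y N hNXY) (X.mkQ a) = 0 := by
      have := congrArg Y.mkQ ha
      simp only [LinearMap.add_apply, map_add, hPP, LinearMap.smul_apply, map_smul, map_zero,
        LinearMap.sub_apply] at this
      rw [← this, LinearMap.add_apply, LinearMap.smul_apply]
      simp only [Submodule.mkQ_apply, Submodule.mapQ_apply]
      abel
    have h1 : a ∈ X :=
      (Submodule.Quotient.mk_eq_zero X).1 ((injective_iff_map_eq_zero _).1 (hinj t) _ h0)
    refine hMX a h1 ?_
    simpa [hPX a h1, hNX a h1] using ha

/-- Reduction modulo one vector of `Ker N`. -/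
theorem HasInvertibleLine.of_vector {m : ℕ} (ih : HasInvertibleLine.{u, v} K m)
    (N M : U →ₗ[K] V) (W : Submodule K (V →ₗ[K] U)) {x : U}
    (hU : finrank K U = m + 1) (hV : finrank K V = m + 1)
    (hNx : N x = 0) (hMx : M x ≠ 0) (hW : finrank K W + 2 ≤ m + 1)
    (hgood : finrank K W + 2 ≤ m ∨ (∃ R ∈ W, R ≠ 0 ∧ ∀ v, R v ∈ Submodule.span K {x}) ∨
      ∃ R ∈ W, R (M x) ∉ Submodule.span K {x})
    {z : U} (hz : z ∉ Submodule.span K {x}) (hNz : N z ∈ Submodule.span K {M x})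
    (hMz : M z ∈ range N ⊔ Submodule.span K {M x}) :
    ∃ A, TraceAgree W A M ∧ ∀ t : K, Function.Injective (A + t • N) := by
  have hx : x ≠ 0 := fun h => hMx (by simp [h])
  have hf : finrank K (Submodule.span K {x}) = 1 := finrank_span_singleton hx
  have hmap : (Submodule.span K {x}).map M = Submodule.span K {M x} := by
    rw [Submodule.map_span, Set.image_singleton]
  refine ih.of_quotient N M W (Submodule.span K {x}) (by omega) (by omega) ?_ ?_ ?_ hz
    (by rwa [hmap]) (by rwa [hmap])
  · intro a ha
    obtain ⟨c, rfl⟩ := Submodule.mem_span_singleton.1 ha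
    simp [hNx]
  · intro a ha h
    obtain ⟨c, rfl⟩ := Submodule.mem_span_singleton.1 ha
    have hc : c = 0 := by simpa [hMx] using h
    simp [hc]
  · rw [hmap]
    have hle : finrank K ↥(W ⊓ Submodule.compatibleMaps (Submodule.span K {M x})
        (Submodule.span K {x})) ≤ finrank K W := Submodule.finrank_mono inf_le_left
    rcases hgood with h | ⟨R, hR, hR0, hRx⟩ | ⟨R, hR, hRx⟩
    · omega
    · have : finrank K ↥(W ⊓ rangeKer (Submodule.span K {x}) (⊥ : Submodule K V)) ≠ 0 := by
        rw [Ne, Submodule.finrank_eq_zero, Submodule.eq_bot_iff]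
        exact fun h => hR0 (h R ⟨hR, mem_rangeKer_bot.2 hRx⟩)
      omega
    · have : finrank K ↥(W ⊓ Submodule.compatibleMaps (Submodule.span K {M x})
          (Submodule.span K {x})) < finrank K W := by
        refine Submodule.finrank_lt_finrank_of_lt (lt_of_le_of_ne inf_le_left fun h => ?_)
        rw [← h] at hR
        exact hRx (hR.2 (Submodule.mem_span_singleton_self _))
      omega

end Quotient

/-! ### Constructions when `M x` and `φ ∘ M` are prescribed -/

section CorankOne

variable {K : Type w} {U : Type u} {V : Type v} [Field K] [AddCommGroup U] [Module K U]
  [AddCommGroup V] [Module K V] [FiniteDimensional K U] [FiniteDimensional K V]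

theorem finrank_ker_inf_ker {c d : U →ₗ[K] K} {a b : U} (hca : c a = 1) (hda : d a = 0)
    (hcb : c b = 0) (hdb : d b = 1) : finrank K ↥(ker c ⊓ ker d) + 2 = finrank K U := by
  have h := LinearMap.finrank_range_add_finrank_ker (c.prod d)
  rw [LinearMap.ker_prod, LinearMap.range_eq_top.2] at h
  · rw [← h, finrank_top]
    simp [add_comm]
  · rintro ⟨p, q⟩
    exact ⟨p • a + q • b, by simp [hca, hda, hcb, hdb]⟩

/-- For a map `N` whose range is killed by `φ`, one may realise a prescribed image of `x` and a
prescribed functional `φ ∘ M` by operators that are regular along the line directed by `N`. -/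
theorem exists_injective_of_dual (hUV : finrank K U = finrank K V) (N M : U →ₗ[K] V) (φ : V →ₗ[K] K) (hφN : ∀ u, φ (N u) = 0) {x z : U} (hNx : N x = 0)
    (hMx : M x = N z) (hNz : N z ≠ 0) (hMz : φ (M z) = 0) (hM : φ ∘ₗ M ≠ 0) :
    ∃ M' : U →ₗ[K] V, M' x = M x ∧ φ ∘ₗ M' = φ ∘ₗ M ∧
      ∀ t : K, Function.Injective (M' + t • N) := by
  have hxz : x ∉ Submodule.span K {z} := by
    intro h
    obtain ⟨a, rfl⟩ := Submodule.mem_span_singleton.1 h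
    have ha : a = 0 := by simpa [hNz] using hNx
    exact hNz (by rw [← hMx, ha]; simp)
  obtain ⟨f, hfx, hfz⟩ := exists_dual_eq_one hxz
  replace hfz : f z = 0 := hfz z (Submodule.mem_span_singleton_self z)
  have hcx : φ (M x) = 0 := by rw [hMx, hφN]
  obtain ⟨e, hce, hfe⟩ : ∃ e, φ (M e) = 1 ∧ f e = 0 := by
    obtain ⟨e, he⟩ : ∃ e, φ (M e) ≠ 0 := by
      by_contra! h
      exact hM (LinearMap.ext h)
    refine ⟨(φ (M e))⁻¹ • e - f ((φ (M e))⁻¹ • e) • x, ?_, ?_⟩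
    · simp [he, hcx]
    · simp [hfx]
  obtain ⟨v, hv⟩ : ∃ v, v = M e := ⟨_, rfl⟩
  have hce' := hce
  rw [← hv] at hce
  have hzv : N z ∉ Submodule.span K {v} := by
    intro h
    obtain ⟨a, ha⟩ := Submodule.mem_span_singleton.1 h
    have h0 : a = 0 := by simpa [hce, hφN] using congrArg φ ha
    exact hNz (by rw [← ha, h0, zero_smul])
  obtain ⟨g, hgz, hgv⟩ := exists_dual_eq_one hzv
  replace hgv : g v = 0 := hgv v (Submodule.mem_span_singleton_self v)
  let c : U →ₗ[K] K := φ ∘ₗ M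
  have hU' := finrank_ker_inf_ker (c := c) (d := f) hce' hfe hcx hfx
  have hV' := finrank_ker_inf_ker (c := φ) (d := g) hce hgv (hφN z) hgz
  let p : U →ₗ[K] ↥(ker c ⊓ ker f) :=
    (LinearMap.id - c.smulRight e - f.smulRight x).codRestrict _ fun u => by
      simp [c, hce', hfe, hcx, hfx]
  let q : V →ₗ[K] ↥(ker φ ⊓ ker g) :=
    (LinearMap.id - φ.smulRight v - g.smulRight (N z)).codRestrict _ fun u => by
      simp [hce, hgv, hφN, hgz]
  have hp : ∀ u, ((p u : ↥(ker c ⊓ ker f)) : U) = u - c u • e - f u • x := fun u => rfl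
  have hq : ∀ y, ((q y : ↥(ker φ ⊓ ker g)) : V) = y - φ y • v - g y • N z := fun y => rfl
  -- Relative to `U = ⟨e⟩ ⊕ ⟨x⟩ ⊕ (ker c ∩ ker f)` and `V = ⟨v⟩ ⊕ ⟨N z⟩ ⊕ (ker φ ∩ ker g)`, the
  -- compression of `N` to the last summands kills `z`, so the unconstrained case fills that block.
  obtain ⟨B, hB⟩ := exists_forall_injective_add_smul _ _ _ rfl (by omega)
    (q ∘ₗ N ∘ₗ (ker c ⊓ ker f).subtype) ⟨z, hMz, hfz⟩
    (fun h => hNz (by rw [show z = 0 from congrArg Subtype.val h, map_zero])) (by ext; simp [hq, hφN, hgz])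
  have hφB : ∀ a, φ (B a) = 0 := fun a => (B a).2.1
  have hgB : ∀ a, g (B a) = 0 := fun a => (B a).2.2
  have hM' : ∀ u, (c.smulRight v + f.smulRight (N z) + (ker φ ⊓ ker g).subtype ∘ₗ B ∘ₗ p) u =
    c u • v + f u • N z + B (p u) := fun u => rfl
  have hpx : p x = 0 := by ext; simp [hp, c, hcx, hfx]
  refine ⟨c.smulRight v + f.smulRight (N z) + (ker φ ⊓ ker g).subtype ∘ₗ B ∘ₗ p, ?_, ?_, ?_⟩
  · rw [hM', hpx, hfx, show c x = 0 from hcx, hMx]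
    simp
  · ext u
    rw [LinearMap.comp_apply, hM']
    simp [hce, hφN, hφB, c]
  · intro t
    rw [injective_iff_map_eq_zero]
    intro u hu
    rw [LinearMap.add_apply, hM', LinearMap.smul_apply] at hu
    have hcu : c u = 0 := by simpa [hce, hφN, hφB] using congrArg φ hu
    have hu' : u = f u • x + (p u : U) := by rw [hp, hcu]; simp
    have hpu : p u = 0 := by
      refine (injective_iff_map_eq_zero _).1 (hB t) _ ?_
      have h1 := congrArg q hu
      have h2 : q (N z) = 0 := by ext; simp [hq, hφN, hgz]
      have h3 : q (B (p u)) = B (p u) := by ext; simp [hq, hφB, hgB]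
      have h4 : N u = N (p u : U) := by
        conv_lhs => rw [hu']
        simp [hNx]
      rw [map_add, map_add, map_add, map_smul, map_smul, map_smul, h2, h3, hcu, h4, map_zero] at h1
      simpa using h1
    rw [hpu] at hu' hu
    have hNu : N u = 0 := by rw [hu']; simp [hNx]
    have hfu : f u = 0 := by simpa [hcu, hNu, hNz] using hu
    rw [hu', hfu]
    simp

/-- The companion matrix of `X² + X + 1`. Over the field with two elements this polynomial has no
root, so `J + t` is injective for every `t`. -/
theorem exists_sq_add_self_add_one {G : Type*} [AddCommGroup G] [Module K G]
    (hG : finrank K G = 2) : ∃ J : G →ₗ[K] G, ∀ g, J (J g) + J g + g = 0 := by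
  have : FiniteDimensional K G := FiniteDimensional.of_finrank_pos (by omega)
  let b := finBasisOfFinrankEq K G hG
  refine ⟨b.constr K ![b 1, -b 0 - b 1], fun g => ?_⟩
  have : (b.constr K ![b 1, -b 0 - b 1]) ∘ₗ (b.constr K ![b 1, -b 0 - b 1]) +
      b.constr K ![b 1, -b 0 - b 1] + LinearMap.id = 0 := by
    refine b.ext fun i => ?_
    fin_cases i
    · simp
    · simp
      abel
  exact LinearMap.congr_fun this g

end CorankOne

/-! ### One-dimensional kernel -/

section CorankOneMain

variable {K : Type w} {U : Type u} {V : Type v} [Field K] [AddCommGroup U] [Module K U]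
  [AddCommGroup V] [Module K V]

/-- `R ∘ (M' - M)` has range in the line of `x`, since `φ ∘ (M' - M) = 0`, and it kills `x`; hence
it squares to zero. -/
theorem traceAgree_of_forall_mem_span {W : Submodule K (V →ₗ[K] U)} {φ : V →ₗ[K] K} {x : U}
    (hW : ∀ R ∈ W, ∀ y, φ y = 0 → R y ∈ Submodule.span K {x}) {M M' : U →ₗ[K] V}
    (hx : M' x = M x) (hφ : φ ∘ₗ M' = φ ∘ₗ M) : TraceAgree W M' M := by
  rw [traceAgree_iff_sub]
  intro R hR
  refine (LinearMap.isNilpotent_trace_of_isNilpotent ⟨2, ?_⟩).eq_zero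
  ext u
  obtain ⟨c, hc⟩ := Submodule.mem_span_singleton.1 (hW R hR ((M' - M) u) (by
    rw [LinearMap.sub_apply, map_sub, sub_eq_zero]
    exact LinearMap.congr_fun hφ u))
  rw [pow_two, Module.End.mul_apply, LinearMap.comp_apply, LinearMap.comp_apply, ← hc]
  simp [hx]

/-- The exceptional case of the field with two elements in dimension three. -/
theorem exists_injective_of_card_two [FiniteDimensional K U] (hU : finrank K U = 3) (hK : ∀ a : K, a = 0 ∨ a = 1)
    (N M : U →ₗ[K] V) (φ : V →ₗ[K] K) (hφN : ∀ u, φ (N u) = 0) {x : U}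
    (hN : ∀ u, N u = 0 → u ∈ Submodule.span K {x}) (hMx : φ (M x) = 1) :
    ∃ M' : U →ₗ[K] V, M' x = M x ∧ φ ∘ₗ M' = φ ∘ₗ M ∧
      ∀ t : K, Function.Injective (M' + t • N) := by
  let c : U →ₗ[K] K := φ ∘ₗ M
  have hcx : c x = 1 := hMx
  have hG : finrank K (ker c) = 2 := by
    have h := LinearMap.finrank_range_add_finrank_ker c
    rw [LinearMap.range_eq_top.2 fun a => ⟨a • x, by simp [hcx]⟩, finrank_top] at h
    simp only [finrank_self] at h
    omega
  obtain ⟨J, hJ⟩ := exists_sq_add_self_add_one (K := K) hG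
  let p : U →ₗ[K] ↥(ker c) :=
    (LinearMap.id - c.smulRight x).codRestrict _ fun u => by simp [hcx]
  have hp : ∀ u, (p u : U) = u - c u • x := fun u => rfl
  have hM' : ∀ u, (c.smulRight (M x) + N ∘ₗ (ker c).subtype ∘ₗ J ∘ₗ p) u =
    c u • M x + N (J (p u)) := fun u => rfl
  refine ⟨c.smulRight (M x) + N ∘ₗ (ker c).subtype ∘ₗ J ∘ₗ p, ?_, ?_, fun t => ?_⟩
  · have hpx : p x = 0 := by ext; simp [hp, hcx]
    rw [hM', hpx, hcx]
    simp
  · ext u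
    rw [LinearMap.comp_apply, hM']
    simp [hφN, hMx, c]
  · rw [injective_iff_map_eq_zero]
    intro u hu
    rw [LinearMap.add_apply, hM', LinearMap.smul_apply] at hu
    have hcu : c u = 0 := by simpa [hMx, hφN] using congrArg φ hu
    have hpu : (p u : U) = u := by simp [hp, hcu]
    have h1 : N (J (p u) + t • p u : ker c) = 0 := by
      rw [Submodule.coe_add, Submodule.coe_smul, hpu, map_add, map_smul]
      simpa [hcu] using hu
    have h2 : J (p u) = -(t • p u) := by
      rw [← add_eq_zero_iff_eq_neg]
      obtain ⟨a, ha⟩ := Submodule.mem_span_singleton.1 (hN _ h1)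
      have h3 : c (J (p u) + t • p u : ker c) = 0 := (J (p u) + t • p u).2
      rw [← ha, map_smul, hcx] at h3
      have h4 : a = 0 := by simpa using h3
      ext
      rw [← ha, h4]
      simp
    have h5 := hJ (p u)
    rw [h2, map_neg, map_smul, h2] at h5
    rw [← hpu]
    rcases hK t with rfl | rfl
    · simpa using h5
    · simpa using h5

variable [FiniteDimensional K U] [FiniteDimensional K V]

/-- A condition of `W` bearing only on `M x` and `φ (M z)` sends `v` to `d x + c z`, so `N (R v) = c
N z`. As `N z` lies outside the image of `W`, `c = 0` and the condition bears on `M x` alone, where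
compatibility is assumed. -/
theorem exists_traceAgree_apply_eq {N M₀ : U →ₗ[K] V} {W : Submodule K (V →ₗ[K] U)}
    {φ : V →ₗ[K] K} (hφN : ∀ u, φ (N u) = 0) {v : V} (hv : φ v = 1) {x z : U} {f : U →ₗ[K] K}
    (hNx : N x = 0) (hf : f x = 1) (hz : N z ∉ W.map (N ∘ₗ LinearMap.applyₗ v))
    (hW : ∀ R ∈ W, (∀ y, R y ∈ Submodule.span K {x}) → f (R (N z)) = f (R (M₀ x))) :
    ∃ M, TraceAgree W M M₀ ∧ M x = N z ∧ φ (M z) = 0 := by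
  obtain ⟨M, hM, hMQ⟩ := exists_traceAgree (W := W)
    (Q := rangeKer (Submodule.span K {x}) ⊥ ⊔ rangeKer (Submodule.span K {z}) (ker φ))
    (A := M₀) (B := f.smulRight (N z)) (by
      rintro R ⟨hR, hRQ⟩
      have hRx : ∀ y, R y ∈ Submodule.span K {x} := by
        obtain ⟨R₁, hR₁, R₂, hR₂, rfl⟩ := Submodule.mem_sup.1 hRQ
        obtain ⟨c, hc⟩ := Submodule.mem_span_singleton.1 (hR₂.1 v)
        obtain ⟨d, hd⟩ := Submodule.mem_span_singleton.1 (hR₁.1 v)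
        have hc0 : c = 0 := by
          by_contra hc0
          refine hz ⟨c⁻¹ • (R₁ + R₂), W.smul_mem _ hR, ?_⟩
          simp [← hc, ← hd, hNx, smul_smul, inv_mul_cancel₀ hc0]
        intro y
        have h := hR₂.2 (y - φ y • v) (by simp [hv])
        rw [map_sub, map_smul, ← hc, hc0, zero_smul, smul_zero, sub_zero] at h
        rw [LinearMap.add_apply, h, add_zero]
        exact hR₁.1 y
      rw [trace_comp_of_mem_span_singleton hRx hf, trace_comp_smulRight, hW R hR hRx])
  refine ⟨M, hM, ?_, ?_⟩
  · have := traceAgree_rangeKer_iff.1 (hMQ.mono le_sup_left) x (Submodule.mem_span_singleton_self x)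
    simpa [hf, sub_eq_zero] using this
  · have := traceAgree_rangeKer_iff.1 (hMQ.mono le_sup_right) z
      (Submodule.mem_span_singleton_self z)
    simpa [hφN] using this

/-- The case where all the trace conditions only involve `M x` and `φ ∘ M`. -/
theorem exists_injective_of_forall_mem_span {m : ℕ} (hm : 2 ≤ m) (hU : finrank K U = m + 1)
    (hV : finrank K V = m + 1) {N M₀ : U →ₗ[K] V} {W : Submodule K (V →ₗ[K] U)}
    (hWm : finrank K W + 1 = m) {φ : V →ₗ[K] K} (hφ : ker φ = range N) {v : V} (hv : φ v = 1)
    {x : U} (hx : x ≠ 0) (hN : ker N = Submodule.span K {x})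
    (hW₀ : ∀ R ∈ W, (∀ y, R y ∈ Submodule.span K {x}) → R = 0)
    (hW : ∀ R ∈ W, ∀ y ∈ range N, R y ∈ Submodule.span K {x}) :
    ∃ A, TraceAgree W A M₀ ∧ ∀ t : K, Function.Injective (A + t • N) := by
  have hφN : ∀ u, φ (N u) = 0 := fun u => by
    rw [← LinearMap.mem_ker, hφ]
    exact LinearMap.mem_range_self N u
  have hNx : N x = 0 := by
    rw [← LinearMap.mem_ker, hN]
    exact Submodule.mem_span_singleton_self x
  have hW' : ∀ R ∈ W, ∀ y, φ y = 0 → R y ∈ Submodule.span K {x} := fun R hR y hy =>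
    hW R hR y (by rw [← hφ]; exact hy)
  obtain ⟨f, hf⟩ := exists_dual_eq_one_of_ne_zero (K := K) hx
  by_contra hcon
  have hneg : ∀ M z, TraceAgree W M M₀ → M x = N z → N z ≠ 0 → φ (M z) = 0 → φ ∘ₗ M = 0 := by
    intro M z hM hMx hz hMz
    by_contra hne
    obtain ⟨M', h1, h2, h3⟩ :=
      exists_injective_of_dual (hU.trans hV.symm) N M φ hφN hNx hMx hz hMz hne
    exact hcon ⟨M', (traceAgree_of_forall_mem_span hW' h1 h2).trans hM, h3⟩
  let B := W.map (N ∘ₗ LinearMap.applyₗ v)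
  have hsolve : ∀ z, N z ∉ B → ∃ M, TraceAgree W M M₀ ∧ M x = N z ∧ φ ∘ₗ M = 0 := by
    intro z hz
    obtain ⟨M, h1, h2, h3⟩ := exists_traceAgree_apply_eq (M₀ := M₀) hφN hv hNx hf hz
      fun R hR hRx => by simp [hW₀ R hR hRx]
    exact ⟨M, h1, h2, hneg M z h1 h2 (fun h => hz (by rw [h]; exact B.zero_mem)) h3⟩
  have hrange : finrank K (range N) = m := by
    have h := LinearMap.finrank_range_add_finrank_ker N
    rw [hN, finrank_span_singleton hx] at h
    omega
  have hB : finrank K B ≤ finrank K W := Submodule.finrank_map_le _ _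
  obtain ⟨z₁, hz₁⟩ : ∃ z, N z ∉ B := by
    by_contra! h
    have : finrank K (range N) ≤ finrank K B := Submodule.finrank_mono (by
      rintro _ ⟨z, rfl⟩
      exact h z)
    omega
  obtain ⟨M₁, hM₁, hM₁x, hM₁φ⟩ := hsolve z₁ hz₁
  -- it suffices to find an operator killing `x`
  have hkey : ¬ ∃ M, TraceAgree W M M₀ ∧ M x = 0 ∧ ∃ R ∈ W, R ≠ 0 ∧ φ (M (R v)) = 0 := by
    rintro ⟨M, hM, hMx, R, hR, hR0, hφR⟩
    obtain ⟨g, hg, hgB⟩ := exists_dual_eq_one hz₁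
    have hRB : ∀ R ∈ W, N (R v) ∈ B := fun R hR => ⟨R, hR, rfl⟩
    have hNR : N (R v) ≠ 0 := by
      intro h
      refine hR0 (hW₀ R hR fun y => ?_)
      rw [← LinearMap.mem_ker, hN] at h
      have h' := hW' R hR (y - φ y • v) (by simp [hv])
      rw [map_sub, map_smul] at h'
      exact (Submodule.sub_mem_iff_left _ (Submodule.smul_mem _ _ h)).1 h'
    obtain ⟨M₂, hM₂, hM₂x, hM₂φ⟩ := hsolve (z₁ + R v) (by
      rw [map_add]
      exact fun h => hz₁ ((Submodule.add_mem_iff_left _ (hRB R hR)).1 h))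
    -- Adding `M₂ - M₁` makes the image of `x` equal to `N (R v)`. The term `a • (g ∘ N) ⊗ v` is
    -- invisible to `W` because `g` kills `B`. So `hneg` applies for every `a`, and comparing `a =
    -- 0` with `a = 1` forces `g ∘ N = 0`.
    have hmain : ∀ a : K, φ ∘ₗ M + a • (g ∘ₗ N) = 0 := by
      intro a
      have hcomp : φ ∘ₗ (M + (M₂ - M₁) + a • (g ∘ₗ N).smulRight v) = φ ∘ₗ M + a • (g ∘ₗ N) := by
        ext u
        have e1 := LinearMap.congr_fun hM₁φ u
        have e2 := LinearMap.congr_fun hM₂φ u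
        simp only [LinearMap.comp_apply, LinearMap.zero_apply] at e1 e2
        simp [e1, e2, hv]
      have h := hneg (M + (M₂ - M₁) + a • (g ∘ₗ N).smulRight v) (R v) ?_ ?_ hNR ?_
      · rwa [hcomp] at h
      · rw [traceAgree_iff_sub] at *
        intro S hS
        have e1 := hM S hS
        have e2 := hM₁ S hS
        have e3 := hM₂ S hS
        have e4 := trace_comp_smulRight S (g ∘ₗ N) v
        rw [LinearMap.comp_apply, hgB _ (hRB S hS)] at e4
        simp only [LinearMap.comp_sub, LinearMap.comp_add, LinearMap.comp_smul, map_sub, map_add,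
          map_smul, e4] at e1 e2 e3 ⊢
        simp only [smul_zero]
        linear_combination e1 - e2 + e3
      · simp [hMx, hM₁x, hM₂x, hNx]
      · have := LinearMap.congr_fun hcomp (R v)
        rw [LinearMap.comp_apply] at this
        rw [this]
        simp [hφR, hgB _ (hRB R hR)]
    have h0 := hmain 0
    have h1 := LinearMap.congr_fun (hmain 1) z₁
    rw [zero_smul, add_zero] at h0
    rw [h0] at h1
    simp [hg] at h1
  by_cases hm2 : m = 2
  · by_cases hK : ∀ a : K, a = 0 ∨ a = 1
    · obtain ⟨M, hM, hMQ⟩ := exists_traceAgree (W := W)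
        (Q := rangeKer (Submodule.span K {x}) (ker φ)) (A := M₀) (B := f.smulRight v) (by
          rintro R ⟨hR, hRQ⟩
          simp [hW₀ R hR hRQ.1])
      have hMx := traceAgree_rangeKer_iff.1 hMQ x (Submodule.mem_span_singleton_self x)
      rw [LinearMap.mem_ker, map_sub, sub_eq_zero, LinearMap.smulRight_apply, hf, one_smul, hv]
        at hMx
      obtain ⟨M', h1, h2, h3⟩ := exists_injective_of_card_two (by omega) hK N M φ hφN (x := x)
        (fun u hu => by rw [← hN]; exact hu) hMx
      exact hcon ⟨M', (traceAgree_of_forall_mem_span hW' h1 h2).trans hM, h3⟩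
    · push Not at hK
      obtain ⟨a, ha0, ha1⟩ := hK
      have ha1' : a - 1 ≠ 0 := sub_ne_zero.2 ha1
      obtain ⟨M₂, hM₂, hM₂x, hM₂φ⟩ := hsolve (a • z₁) (by
        rw [map_smul]
        exact fun h => hz₁ ((Submodule.smul_mem_iff _ ha0).1 h))
      obtain ⟨R, hR, hR0⟩ := (Submodule.ne_bot_iff W).1 (by
        rintro rfl
        rw [finrank_bot] at hWm
        omega)
      -- This affine combination kills `x`, as `M₂ x = a • M₁ x`; the denominator is why a scalar
      -- other than `0` and `1` is needed.
      refine hkey ⟨(a - 1)⁻¹ • (a • M₁ - M₂), ?_, ?_, R, hR, hR0, ?_⟩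
      · intro S hS
        have e1 := hM₁ S hS
        have e2 := hM₂ S hS
        simp only [LinearMap.comp_smul, LinearMap.comp_sub, map_smul, map_sub, smul_eq_mul, e1, e2]
        field_simp
      · simp [hM₁x, hM₂x]
      · have e1 := LinearMap.congr_fun hM₁φ (R v)
        have e2 := LinearMap.congr_fun hM₂φ (R v)
        simp only [LinearMap.comp_apply, LinearMap.zero_apply] at e1 e2
        simp [e1, e2]
  · obtain ⟨M, hM, hMQ⟩ := exists_traceAgree (W := W)
      (Q := rangeKer (Submodule.span K {x}) ⊥) (A := M₀) (B := 0) (by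
        rintro R ⟨hR, hRQ⟩
        simp [hW₀ R hR hRQ.1])
    have hMx := traceAgree_rangeKer_iff.1 hMQ x (Submodule.mem_span_singleton_self x)
    -- Here `dim W ≥ 2`, so the single functional `R ↦ φ (M (R v))` has a nonzero zero in `W`.
    have h := finrank_map_add_finrank_inf_ker (φ ∘ₗ M ∘ₗ LinearMap.applyₗ v) W
    have h' := (Submodule.finrank_le (W.map (φ ∘ₗ M ∘ₗ LinearMap.applyₗ v))).trans
      (finrank_self K).le
    obtain ⟨R, hR, hR0⟩ := (Submodule.ne_bot_iff (W ⊓ ker (φ ∘ₗ M ∘ₗ LinearMap.applyₗ v))).1 (by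
        intro h0
        rw [h0, finrank_bot] at h
        omega)
    exact hkey ⟨M, hM, by simpa using hMx, R, hR.1, hR0, hR.2⟩

theorem HasInvertibleLine.of_corank_one {m : ℕ} (ih : HasInvertibleLine.{u, v} K m) (hm : 2 ≤ m)
    (hU : finrank K U = m + 1) (hV : finrank K V = m + 1) {N M₀ : U →ₗ[K] V}
    {W : Submodule K (V →ₗ[K] U)} (hWm : finrank K W + 1 ≤ m) {x : U} (hx : x ≠ 0)
    (hN : ker N = Submodule.span K {x}) (hM₀ : M₀ x ∈ range N) :
    ∃ A, TraceAgree W A M₀ ∧ ∀ t : K, Function.Injective (A + t • N) := by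
  have hNx : N x = 0 := by
    rw [← LinearMap.mem_ker, hN]
    exact Submodule.mem_span_singleton_self x
  obtain ⟨f, hf⟩ := exists_dual_eq_one_of_ne_zero (K := K) hx
  have hrange : finrank K (range N) = m := by
    have h := LinearMap.finrank_range_add_finrank_ker N
    rw [hN, finrank_span_singleton hx] at h
    omega
  obtain ⟨v, hvN⟩ : ∃ v, v ∉ range N := by
    by_contra! h
    rw [(Submodule.eq_top_iff').2 h, finrank_top] at hrange
    omega
  obtain ⟨φ, hv, hφN⟩ := exists_dual_eq_one hvN
  have hφ : ker φ = range N := by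
    refine (Submodule.eq_of_le_of_finrank_le (fun y hy => hφN y hy) ?_).symm
    have h := LinearMap.finrank_range_add_finrank_ker φ
    rw [LinearMap.range_eq_top.2 fun a => ⟨a • v, by simp [hv]⟩, finrank_top, finrank_self] at h
    omega
  replace hφN : ∀ u, φ (N u) = 0 := fun u => hφN _ (LinearMap.mem_range_self N u)
  let B := W.map (N ∘ₗ LinearMap.applyₗ v)
  have hred : ∀ z, N z ∉ B →
      (∀ R ∈ W, (∀ y, R y ∈ Submodule.span K {x}) → f (R (N z)) = f (R (M₀ x))) →
      (finrank K W + 2 ≤ m ∨ (∃ R ∈ W, R ≠ 0 ∧ ∀ v, R v ∈ Submodule.span K {x}) ∨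
        ∃ R ∈ W, R (N z) ∉ Submodule.span K {x}) →
      ∃ A, TraceAgree W A M₀ ∧ ∀ t : K, Function.Injective (A + t • N) := by
    intro z hz hzW hgood
    have hNz : N z ≠ 0 := fun h => hz (by rw [h]; exact B.zero_mem)
    obtain ⟨M, hM, hMx, hMz⟩ := exists_traceAgree_apply_eq hφN hv hNx hf hz hzW
    obtain ⟨A, hA, hinj⟩ := ih.of_vector N M W hU hV hNx (by rwa [hMx]) (by omega)
      (by rwa [hMx]) (z := z)
      (by
        intro h
        rw [← hN] at h
        exact hNz h)
      (by rw [hMx]; exact Submodule.mem_span_singleton_self _)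
      (Submodule.mem_sup_left (by rw [← hφ]; exact hMz))
    exact ⟨A, hA.trans hM, hinj⟩
  by_cases hW₀ : ∀ R ∈ W, (∀ y, R y ∈ Submodule.span K {x}) → R = 0
  · have hBr : ¬ range N ≤ B := fun h => by
      have h1 := Submodule.finrank_mono h
      have h2 : finrank K B ≤ finrank K W := Submodule.finrank_map_le _ _
      omega
    have hcompat : ∀ z, ∀ R ∈ W, (∀ y, R y ∈ Submodule.span K {x}) →
        f (R (N z)) = f (R (M₀ x)) := fun z R hR hRx => by simp [hW₀ R hR hRx]
    by_cases hWm' : finrank K W + 2 ≤ m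
    · obtain ⟨_, ⟨z, rfl⟩, hz⟩ := SetLike.not_le_iff_exists.1 hBr
      exact hred z hz (hcompat z) (Or.inl hWm')
    · by_cases hW : ∀ R ∈ W, ∀ y ∈ range N, R y ∈ Submodule.span K {x}
      · exact exists_injective_of_forall_mem_span hm hU hV (by omega) hφ hv hx hN hW₀ hW
      · push Not at hW
        obtain ⟨R, hR, y, hy, hRy⟩ := hW
        obtain ⟨_, ⟨z, rfl⟩, hz, hz'⟩ := exists_mem_notMem_notMem hBr
          (B := (Submodule.span K {x}).comap R) (fun h => hRy (h hy))
        exact hred z hz (hcompat z) (Or.inr (Or.inr ⟨R, hR, hz'⟩))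
  · push Not at hW₀
    obtain ⟨R₀, hR₀, hR₀x, hR₀0⟩ := hW₀
    -- Conditions with range in `⟨x⟩` confine the choice of `M x`, but they also shrink `B` by their
    -- number. The two losses balance, so `M₀ x + D` is not contained in `B`.
    obtain ⟨D, hDN, hD, hfD⟩ := exists_submodule_dual_apply_eq_zero f (range N)
      (A₀ := (⊥ : Submodule K (V →ₗ[K] U))) (A₁ := W ⊓ rangeKer (Submodule.span K {x}) ⊥) bot_le
      (fun R hR y _ => by simp [(Submodule.mem_bot K).1 hR])
    have hfB : finrank K B + finrank K ↥(W ⊓ rangeKer (Submodule.span K {x}) (⊥ : Submodule K V)) ≤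
        finrank K W := by
      refine finrank_map_add_le _ inf_le_left fun R hR => ?_
      have := hR.2.1 v
      rwa [← hN] at this
    rw [finrank_bot] at hfD
    obtain ⟨w, hw, hwB⟩ : ∃ w ∈ D, M₀ x + w ∉ B := by
      by_contra! h
      have h0 : M₀ x ∈ B := by simpa using h 0 D.zero_mem
      have : finrank K D ≤ finrank K B := Submodule.finrank_mono fun w hw =>
        (Submodule.add_mem_iff_right _ h0).1 (h w hw)
      omega
    obtain ⟨z, hz⟩ := (range N).add_mem hM₀ (hDN hw)
    refine hred z (by rwa [hz]) (fun R hR hRx => ?_) (Or.inr (Or.inl ⟨R₀, hR₀, hR₀0, hR₀x⟩))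
    rw [hz, map_add, map_add, hD w hw R ⟨hR, mem_rangeKer_bot.2 hRx⟩, add_zero]

end CorankOneMain

/-! ### Kernel of dimension at least two: splitting off one vector -/

section HigherCorank

variable {K : Type w} {U : Type u} {V : Type v} [Field K] [AddCommGroup U] [Module K U]
  [AddCommGroup V] [Module K V] [FiniteDimensional K U] [FiniteDimensional K V]

/-- The final alternative is what `HasInvertibleLine.of_vector` needs to lose one condition. If it
always failed, the conditions in `W` would be too rigid. The argument separates according to whether
`W` contains a nonzero condition on the induced operator alone (the space `L`). -/
theorem exists_reducible_operator (hUV : finrank K U = finrank K V) {N M₀ : U →ₗ[K] V}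
    {W : Submodule K (V →ₗ[K] U)} (hk : 2 ≤ finrank K (ker N)) (hW : W ≠ ⊥)
    {x₁ u₁ : U} (hx₁ : x₁ ∈ ker N) (hu₁ : u₁ ∈ ker N) (hu₁0 : u₁ ≠ 0)
    (hMu₁ : M₀ u₁ ∈ range N) (hMx₁ : M₀ x₁ ∉ range N) :
    ∃ M x u, TraceAgree W M M₀ ∧ x ∈ ker N ∧ u ∈ ker N ∧ u ≠ 0 ∧ M u ∈ range N ∧ M x ∉ range N ∧
      ((∃ R ∈ W, R ≠ 0 ∧ ∀ v, R v ∈ Submodule.span K {x}) ∨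
        ∃ R ∈ W, R (M x) ∉ Submodule.span K {x}) := by
  by_contra! hneg
  obtain ⟨R₀, hR₀, hR₀0⟩ := (Submodule.ne_bot_iff W).1 hW
  let L := W ⊓ rangeKer (ker N) (range N)
  by_cases hL : L = ⊥
  · -- every induced operator can be prescribed
    obtain ⟨u, hu, hux₁⟩ := exists_mem_notMem_span_singleton x₁ hk
    have hx₁0 : x₁ ≠ 0 := by
      rintro rfl
      simp at hMx₁
    have hu0 : u ≠ 0 := fun h => hux₁ (by rw [h]; exact Submodule.zero_mem _)
    have hxu := notMem_span_singleton_symm hx₁0 hux₁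
    have hpres : ∀ y, ∃ M, TraceAgree W M M₀ ∧ M x₁ - y ∈ range N ∧ M u ∈ range N := by
      intro y
      obtain ⟨M₁, h₁, h₂⟩ := exists_apply_eq_apply_eq_zero (V := V) hxu y
      obtain ⟨M, hM, hMQ⟩ := exists_traceAgree (W := W) (Q := rangeKer (ker N) (range N)) (A := M₀)
        (B := M₁) (by
          intro R hR
          have : R = 0 := by simpa [L, hL] using (show R ∈ L from hR)
          simp [this])
      rw [traceAgree_rangeKer_iff] at hMQ
      exact ⟨M, hM, by simpa [h₁] using hMQ x₁ hx₁, by simpa [h₂] using hMQ u hu⟩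
    have hout : ∀ {y : V} {M : U →ₗ[K] V}, y ∉ range N → M x₁ - y ∈ range N → M x₁ ∉ range N :=
      fun hy h h' => hy (by simpa using (range N).sub_mem h' h)
    have hp : ∀ R ∈ W, (∀ y, R y ∈ Submodule.span K {x₁}) → R = 0 := by
      intro R hR hRx
      by_contra hR0
      obtain ⟨M, hM, h1, h2⟩ := hpres (M₀ x₁)
      obtain ⟨y, hy⟩ := (hneg M x₁ u hM hx₁ hu hu0 h2 (hout hMx₁ h1)).1 R hR hR0
      exact hy (hRx y)
    by_cases hb : W ⊓ (rangeKer (Submodule.span K {x₁}) ⊥ ⊔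
        rangeKer (Submodule.span K {u}) (range N)) = ⊥
    · obtain ⟨y₁, hy₁⟩ : ∃ y, R₀ y ∉ Submodule.span K {x₁} := by
        by_contra! h
        exact hR₀0 (hp R₀ hR₀ h)
      obtain ⟨y, -, hyN, hyR⟩ := exists_mem_notMem_notMem (Y := ⊤) (A := range N)
        (B := (Submodule.span K {x₁}).comap R₀) (fun h => hMx₁ (h trivial))
        (fun h => hy₁ (h (x := y₁) trivial))
      obtain ⟨M₁, h₁, h₂⟩ := exists_apply_eq_apply_eq_zero (V := V) hxu y
      obtain ⟨M, hM, hMQ⟩ := exists_traceAgree (W := W) (Q := rangeKer (Submodule.span K {x₁}) ⊥ ⊔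
        rangeKer (Submodule.span K {u}) (range N)) (A := M₀) (B := M₁) (by
          intro R hR
          have : R = 0 := by rwa [hb, Submodule.mem_bot] at hR
          simp [this])
      have hMx := traceAgree_rangeKer_iff.1 (hMQ.mono le_sup_left) x₁
        (Submodule.mem_span_singleton_self x₁)
      have hMu := traceAgree_rangeKer_iff.1 (hMQ.mono le_sup_right) u
        (Submodule.mem_span_singleton_self u)
      rw [Submodule.mem_bot, h₁, sub_eq_zero] at hMx
      rw [h₂, sub_zero] at hMu
      refine hyR ?_
      rw [Submodule.mem_comap, ← hMx]
      exact (hneg M x₁ u hM hx₁ hu hu0 hMu (by rwa [hMx])).2 R₀ hR₀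
    · obtain ⟨R, ⟨hR, hRQ⟩, hR0⟩ := (Submodule.ne_bot_iff _).1 hb
      obtain ⟨R₁, hR₁, R₂, hR₂, rfl⟩ := Submodule.mem_sup.1 hRQ
      obtain ⟨y, hy⟩ : ∃ y, R₂ y ≠ 0 := by
        by_contra! h
        have h0 : R₂ = 0 := LinearMap.ext h
        rw [h0, add_zero] at hR hR0
        exact hR0 (hp R₁ hR hR₁.1)
      have hyN : y ∉ range N := fun h => hy (hR₂.2 y h)
      obtain ⟨M, hM, h1, h2⟩ := hpres y
      have h3 := (hneg M x₁ u hM hx₁ hu hu0 h2 (hout hyN h1)).2 _ hR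
      have h4 := hR₂.2 _ h1
      rw [map_sub, sub_eq_zero] at h4
      rw [LinearMap.add_apply, h4, Submodule.add_mem_iff_right _ (hR₁.1 _)] at h3
      obtain ⟨a, ha⟩ := Submodule.mem_span_singleton.1 (hR₂.1 y)
      have ha0 : a ≠ 0 := fun h => hy (by rw [← ha, h, zero_smul])
      rw [← ha, Submodule.smul_mem_iff _ ha0] at h3
      exact hux₁ h3
  · have hkill : ∀ M x u, TraceAgree W M M₀ → x ∈ ker N → u ∈ ker N → u ≠ 0 → M u ∈ range N →
        ∀ R ∈ L, R (M x) = 0 := by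
      intro M x u hM hx hu hu0 hMu R hR
      have hspan : ∀ a ∈ ker N, R (M a) ∈ Submodule.span K {a} := by
        intro a ha
        by_cases hMa : M a ∈ range N
        · rw [hR.2.2 _ hMa]
          exact Submodule.zero_mem _
        · exact (hneg M a u hM ha hu hu0 hMu hMa).2 R hR.1
      have hRu : R (M u) = 0 := hR.2.2 _ hMu
      by_cases hxu : u ∈ Submodule.span K {x}
      · obtain ⟨a, rfl⟩ := Submodule.mem_span_singleton.1 hxu
        have ha : a ≠ 0 := fun h => hu0 (by rw [h, zero_smul])
        simpa [ha] using hRu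
      · obtain ⟨a, ha⟩ := Submodule.mem_span_singleton.1 (hspan x hx)
        obtain ⟨b, hb⟩ := Submodule.mem_span_singleton.1 (hspan (x + u) ((ker N).add_mem hx hu))
        rw [map_add, map_add, hRu, add_zero, ← ha, smul_add] at hb
        have hb0 : b = 0 := by
          by_contra hb0
          refine hxu ((Submodule.smul_mem_iff _ hb0).1 ?_)
          rw [← eq_sub_iff_add_eq', ← sub_smul] at hb
          exact Submodule.mem_span_singleton.2 ⟨_, hb.symm⟩
        rw [← ha, ← hb, hb0]
        simp
    have hrefl : TraceAgree W M₀ M₀ := fun _ _ => rfl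
    have hp := (hneg M₀ x₁ u₁ hrefl hx₁ hu₁ hu₁0 hMu₁ hMx₁).1
    obtain ⟨R₁, hR₁, hR₁0⟩ := (Submodule.ne_bot_iff _).1 hL
    obtain ⟨y, hy⟩ : ∃ y, R₁ y ≠ 0 := by
      by_contra! h
      exact hR₁0 (LinearMap.ext h)
    have hx₁0 : x₁ ≠ 0 := by
      rintro rfl
      simp at hMx₁
    obtain ⟨f, hf⟩ := exists_dual_eq_one_of_ne_zero (K := K) hx₁0
    obtain ⟨M₁, hM₁, hMQ⟩ := exists_traceAgree (W := W)
      (Q := rangeKer (Submodule.span K {x₁}) ⊥) (A := M₀) (B := f.smulRight y) (by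
        rintro R ⟨hR, hRQ⟩
        by_contra hne
        obtain ⟨y, hy⟩ := hp R hR (by rintro rfl; simp at hne)
        exact hy (hRQ.1 y))
    have hM₁x := traceAgree_rangeKer_iff.1 hMQ x₁ (Submodule.mem_span_singleton_self x₁)
    rw [Submodule.mem_bot, sub_eq_zero, LinearMap.smulRight_apply, hf, one_smul] at hM₁x
    -- the operator induced by `M₁` is bijective
    have hinj : Function.Injective ((range N).mkQ ∘ₗ M₁ ∘ₗ (ker N).subtype) := by
      rw [injective_iff_map_eq_zero]
      rintro ⟨u, hu⟩ h
      by_contra hu0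
      refine hy ?_
      rw [← hM₁x]
      exact hkill M₁ x₁ u hM₁ hx₁ hu (fun h => hu0 (by simp [h]))
        ((Submodule.Quotient.mk_eq_zero _).1 h) R₁ hR₁
    have hdim : finrank K (ker N) = finrank K (V ⧸ range N) := by
      have h1 := LinearMap.finrank_range_add_finrank_ker N
      have h2 := Submodule.finrank_quotient_add_finrank (range N)
      omega
    obtain ⟨⟨a, ha⟩, haM⟩ := (LinearMap.injective_iff_surjective_of_finrank_eq_finrank hdim).1 hinj
      ((range N).mkQ (M₀ x₁))
    have haM' : M₁ a - M₀ x₁ ∈ range N := by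
      rw [← Submodule.Quotient.mk_eq_zero, Submodule.Quotient.mk_sub, sub_eq_zero]
      exact haM
    have ha0 : a ≠ 0 := by
      rintro rfl
      rw [map_zero, zero_sub, neg_mem_iff] at haM'
      exact hMx₁ haM'
    obtain ⟨g, hg⟩ := exists_dual_eq_one_of_ne_zero (K := K) ha0
    -- The elements of `L` kill `M₀ x₁`, so subtracting `g ⊗ M₀ x₁` from the induced operator is
    -- allowed. The result kills `a`, and `hkill` then gives `R₁ y = 0`.
    obtain ⟨M₂, hM₂, hMQ₂⟩ := exists_traceAgree (W := W) (Q := rangeKer (ker N) (range N))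
      (A := M₁) (B := M₁ - g.smulRight (M₀ x₁)) (by
        intro R hR
        rw [LinearMap.comp_sub, map_sub, trace_comp_smulRight,
          hkill M₀ x₁ u₁ hrefl hx₁ hu₁ hu₁0 hMu₁ R hR, map_zero, sub_zero])
    rw [traceAgree_rangeKer_iff] at hMQ₂
    have hM₂a : M₂ a ∈ range N := by
      have h := (range N).add_mem (hMQ₂ a ha) haM'
      simpa [hg] using h
    have h1 := hkill M₂ x₁ a (hM₂.trans hM₁) hx₁ ha ha0 hM₂a R₁ hR₁
    have h2 := hR₁.2.2 _ (hMQ₂ x₁ hx₁)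
    have h3 := hkill M₀ x₁ u₁ hrefl hx₁ hu₁ hu₁0 hMu₁ R₁ hR₁
    refine hy ?_
    simpa [h1, h3, hM₁x] using h2

/-- If every singular induced operator vanishes, then many trace conditions bear on the induced
operator only. -/
theorem le_finrank_inf_rangeKer (hUV : finrank K U = finrank K V) {N M₀ : U →ₗ[K] V}
    {W : Submodule K (V →ₗ[K] U)} {u : U} (hu : u ∈ ker N) (hu0 : u ≠ 0) (hMu : M₀ u ∈ range N)
    (h : ∀ M, TraceAgree W M M₀ → M u ∈ range N → ∀ x ∈ ker N, M x ∈ range N) :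
    finrank K (ker N) * finrank K (ker N) ≤
      finrank K ↥(W ⊓ rangeKer (ker N) (range N)) + finrank K (ker N) := by
  have hdim : finrank K (V ⧸ range N) = finrank K (ker N) := by
    have h1 := LinearMap.finrank_range_add_finrank_ker N
    have h2 := Submodule.finrank_quotient_add_finrank (range N)
    omega
  -- By hypothesis the conditions of `W`, together with those on the class of `M u`, determine the
  -- whole induced operator; the modular law then isolates the part in `W`.
  have hle : rangeKer (ker N) (range N) ≤ W ⊔ rangeKer (Submodule.span K {u}) (range N) := by
    refine le_sup_of_trace_comp fun P hPW hPu R hR => ?_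
    refine trace_comp_eq_zero_of_mem_rangeKer hR fun x hx => ?_
    have hPu' := map_mem_of_trace_comp_eq_zero hPu u (Submodule.mem_span_singleton_self u)
    have hrefl := h M₀ (fun _ _ => rfl) hMu x hx
    have := h (M₀ + P) (traceAgree_iff_sub.2 (by simpa using hPW))
      ((range N).add_mem hMu hPu') x hx
    exact (Submodule.add_mem_iff_right _ hrefl).1 this
  have hle' : rangeKer (Submodule.span K {u}) (range N) ≤ rangeKer (ker N) (range N) :=
    fun R hR => ⟨fun v => (Submodule.span_singleton_le_iff_mem u _).2 hu (hR.1 v), hR.2⟩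
  have heq : rangeKer (ker N) (range N) ≤
      rangeKer (Submodule.span K {u}) (range N) ⊔ W ⊓ rangeKer (ker N) (range N) := by
    rw [sup_comm] at hle
    rw [← sup_inf_assoc_of_le _ hle']
    exact le_inf hle le_rfl
  have h1 := (Submodule.finrank_mono heq).trans (Submodule.finrank_add_le_finrank_add_finrank _ _)
  rw [finrank_rangeKer, finrank_rangeKer, hdim, finrank_span_singleton hu0] at h1
  omega

end HigherCorank

/-! ### Zero induced operator: splitting off the whole kernel -/

section BlockReduction

variable {K : Type w} {U : Type u} {V : Type v} [Field K] [AddCommGroup U] [Module K U]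
  [AddCommGroup V] [Module K V] [FiniteDimensional K U] [FiniteDimensional K V]

/-- Each nonzero `x ∈ Ker N` with `M x ∈ B` is repaired by adding `f ⊗ w` on `Ker N`, with `f x = 1`
and `w ∈ Im N` outside `M(Ker N) + B`. The new bad vectors are old ones lying in `ker f`, so their
dimension drops. The inequality guarantees room for `w`. -/
theorem exists_traceAgree_injOn_ker {N : U →ₗ[K] V} {W : Submodule K (V →ₗ[K] U)} (B : Submodule K V)
    (hW : finrank K B + finrank K ↥(W ⊓ rangeKer (ker N) ⊥) + finrank K (ker N) ≤
      finrank K (range N) + finrank K ↥(W ⊓ rangeKer (ker N) (range N))) :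
    ∀ (j : ℕ) (M : U →ₗ[K] V), (∀ x ∈ ker N, M x ∈ range N) →
      finrank K ↥(ker N ⊓ B.comap M) ≤ j →
      ∃ M', TraceAgree W M' M ∧ (∀ x ∈ ker N, M' x ∈ range N) ∧
        ∀ x ∈ ker N, M' x ∈ B → x = 0 := by
  intro j
  induction j with
  | zero =>
    intro M hM hj
    rw [Nat.le_zero, Submodule.finrank_eq_zero, Submodule.eq_bot_iff] at hj
    exact ⟨M, fun _ _ => rfl, hM, fun x hx hxB => hj x ⟨hx, hxB⟩⟩
  | succ j ih =>
    intro M hM hj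
    by_cases hx : ∀ x ∈ ker N, M x ∈ B → x = 0
    · exact ⟨M, fun _ _ => rfl, hM, hx⟩
    push Not at hx
    obtain ⟨x, hx, hxB, hx0⟩ := hx
    obtain ⟨f, hf⟩ := exists_dual_eq_one_of_ne_zero (K := K) hx0
    obtain ⟨D, hDN, hD, hfD⟩ := exists_submodule_dual_apply_eq_zero f (range N)
      (A₀ := W ⊓ rangeKer (ker N) (range N)) (A₁ := W ⊓ rangeKer (ker N) ⊥)
      (inf_le_inf_left _ fun R hR => mem_rangeKer_bot.2 hR.1)
      (fun R hR y hy => by rw [hR.2.2 y hy, map_zero])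
    -- The bad vector `x` saves one dimension: either `M` kills it, or `M(Ker N)` meets `B`
    -- nontrivially.
    have hT : finrank K ↥((ker N).map M ⊔ B) + 1 ≤ finrank K (ker N) + finrank K B := by
      have h1 := Submodule.finrank_sup_add_finrank_inf_eq ((ker N).map M) B
      have h2 := finrank_map_add_finrank_inf_ker M (ker N)
      by_cases hMx : M x = 0
      · have : finrank K ↥(ker N ⊓ ker M) ≠ 0 := by
          rw [Ne, Submodule.finrank_eq_zero, Submodule.eq_bot_iff]
          exact fun h => hx0 (h x ⟨hx, hMx⟩)
        omega
      · have : finrank K ↥((ker N).map M ⊓ B) ≠ 0 := by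
          rw [Ne, Submodule.finrank_eq_zero, Submodule.eq_bot_iff]
          exact fun h => hMx (h (M x) ⟨Submodule.mem_map_of_mem hx, hxB⟩)
        omega
    obtain ⟨w, hw, hwT⟩ := SetLike.not_le_iff_exists.1
      (show ¬ D ≤ (ker N).map M ⊔ B from fun h => by
        have := Submodule.finrank_mono h
        omega)
    obtain ⟨M', hM', hMQ⟩ := exists_traceAgree (W := W) (Q := rangeKer (ker N) ⊥) (A := M)
      (B := M + f.smulRight w) (by
        intro R hR
        rw [LinearMap.comp_add, map_add, trace_comp_smulRight, hD w hw R hR, add_zero])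
    have hM'x : ∀ y ∈ ker N, M' y = M y + f y • w := fun y hy => by
      simpa [sub_eq_zero] using traceAgree_rangeKer_iff.1 hMQ y hy
    obtain ⟨M'', h1, h2, h3⟩ := ih M' (fun y hy => by
        rw [hM'x y hy]
        exact (range N).add_mem (hM y hy) ((range N).smul_mem _ (hDN hw))) (by
      have hsub : ∀ y ∈ ker N ⊓ B.comap M', f y = 0 := by
        rintro y ⟨hy, hyB⟩
        rw [SetLike.mem_coe, Submodule.mem_comap, hM'x y hy] at hyB
        by_contra hfy
        refine hwT ((Submodule.smul_mem_iff _ hfy).1 ?_)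
        rw [← add_sub_cancel_left (M y) (f y • w)]
        exact Submodule.sub_mem _ (Submodule.mem_sup_right hyB)
          (Submodule.mem_sup_left (Submodule.mem_map_of_mem hy))
      have : ker N ⊓ B.comap M' < ker N ⊓ B.comap M := by
        refine lt_of_le_of_ne (fun y hy => ⟨hy.1, ?_⟩) fun h => ?_
        · have hyB := hy.2
          rw [SetLike.mem_coe, Submodule.mem_comap, hM'x y hy.1, hsub y hy] at hyB
          simpa using hyB
        · have := hsub x (by rw [h]; exact ⟨hx, hxB⟩)
          rw [hf] at this
          exact one_ne_zero this
      have := Submodule.finrank_lt_finrank_of_lt this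
      omega)
    exact ⟨M'', h1.trans hM', h2, h3⟩

/-- The case where `M₀` induces the zero operator and many trace conditions bear on the induced
operator only. -/
theorem HasInvertibleLine.of_induced_eq_zero (hUV : finrank K U = finrank K V) {N M₀ : U →ₗ[K] V}
    (ih : HasInvertibleLine.{u, v} K (finrank K (range N))) {W : Submodule K (V →ₗ[K] U)}
    (hWn : finrank K W + 2 ≤ finrank K U) (hk : 2 ≤ finrank K (ker N))
    (hM₀ : ∀ x ∈ ker N, M₀ x ∈ range N)
    (hd : 2 * finrank K (ker N) ≤ finrank K ↥(W ⊓ rangeKer (ker N) (range N)) + 2) :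
    ∃ A, TraceAgree W A M₀ ∧ ∀ t : K, Function.Injective (A + t • N) := by
  have hrk := LinearMap.finrank_range_add_finrank_ker N
  obtain ⟨v, hvN⟩ : ∃ v, v ∉ range N := by
    by_contra! h
    rw [(Submodule.eq_top_iff').2 h, finrank_top] at hrk
    omega
  obtain ⟨φ, hv, hφN⟩ := exists_dual_eq_one hvN
  have hφr := LinearMap.finrank_range_add_finrank_ker φ
  rw [LinearMap.range_eq_top.2 fun a => ⟨a • v, by simp [hv]⟩, finrank_top, finrank_self] at hφr
  -- Keeping `M(Ker N)` away from `B` makes it compatible with `W` to keep `M` on `Ker N` and to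
  -- impose `φ ∘ M' = 0` on `Z = N⁻¹(M(Ker N))`.
  let B := (W ⊓ Submodule.compatibleMaps (ker φ) (ker N)).map (N ∘ₗ LinearMap.applyₗ v)
  have hB : finrank K B + finrank K ↥(W ⊓ rangeKer (ker N) (⊥ : Submodule K V)) ≤
      finrank K W := by
    refine le_trans ?_ (Submodule.finrank_mono (inf_le_left (a := W)
      (b := Submodule.compatibleMaps (ker φ) (ker N))))
    exact finrank_map_add_le _ (fun R hR => ⟨hR.1, fun y _ => hR.2.1 y⟩) fun R hR => hR.2.1 v
  have hLK : finrank K ↥(W ⊓ rangeKer (ker N) (range N)) ≤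
      finrank K ↥(W ⊓ rangeKer (ker N) (⊥ : Submodule K V)) :=
    Submodule.finrank_mono (inf_le_inf_left _ fun R hR => mem_rangeKer_bot.2 hR.1)
  obtain ⟨M, hM, hMN, hMB⟩ := exists_traceAgree_injOn_ker (W := W) B (by omega) _ M₀ hM₀ le_rfl
  let Z := ((ker N).map M).comap N
  have hφM : ∀ x ∈ ker N, φ (M x) = 0 := fun x hx => hφN _ (hMN x hx)
  obtain ⟨M', hM', hMQ⟩ := exists_traceAgree (W := W)
    (Q := rangeKer (ker N) ⊥ ⊔ rangeKer Z (ker φ)) (A := M)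
    (B := M - (φ ∘ₗ M).smulRight v) (by
      rintro R ⟨hR, hRQ⟩
      rw [LinearMap.comp_sub, map_sub, trace_comp_smulRight, LinearMap.comp_apply, hφM, sub_zero]
      obtain ⟨R₁, hR₁, R₂, hR₂, rfl⟩ := Submodule.mem_sup.1 hRQ
      have hNR : N ((R₁ + R₂) v) = N (R₂ v) := by
        rw [LinearMap.add_apply, map_add, LinearMap.mem_ker.1 (hR₁.1 v), zero_add]
      obtain ⟨y, hy, hyR⟩ := hR₂.1 v
      have hyB : M y ∈ B := ⟨R₁ + R₂, ⟨hR, fun b hb => by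
        rw [Submodule.mem_comap, LinearMap.add_apply, hR₂.2 b hb, add_zero]
        exact hR₁.1 b⟩, by rw [hyR, ← hNR]; rfl⟩
      rw [LinearMap.mem_ker, hNR, ← hyR, hMB y hy hyB, map_zero])
  have hM'x : ∀ x ∈ ker N, M' x = M x := fun x hx => by
    have h := traceAgree_rangeKer_iff.1 (hMQ.mono le_sup_left) x hx
    rw [Submodule.mem_bot, sub_eq_zero] at h
    rw [h, LinearMap.sub_apply, LinearMap.smulRight_apply, LinearMap.comp_apply, hφM x hx,
      zero_smul, sub_zero]
  have hM'Z : ∀ z ∈ Z, φ (M' z) = 0 := fun z hz => by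
    have h := traceAgree_rangeKer_iff.1 (hMQ.mono le_sup_right) z hz
    simpa [hv] using h
  have hmap : (ker N).map M' = (ker N).map M := by
    ext y
    constructor
    · rintro ⟨x, hx, rfl⟩
      exact ⟨x, hx, (hM'x x hx).symm⟩
    · rintro ⟨x, hx, rfl⟩
      exact ⟨x, hx, hM'x x hx⟩
  have hMinj : ∀ x ∈ ker N, M x = 0 → x = 0 := fun x hx h =>
    hMB x hx (by rw [h]; exact B.zero_mem)
  -- With `k = dim Ker N`, `dim Z = 2k`, while `M'` sends `Z` into `ker φ`, of dimension `k - 1`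
  -- modulo `Im N`. At least `k + 1` dimensions of `Z` go into `Im N`, more than `Ker N` can hold.
  obtain ⟨z, hz, hzN⟩ : ∃ z ∈ Z ⊓ ker ((range N).mkQ ∘ₗ M'), z ∉ ker N := by
    refine SetLike.not_le_iff_exists.1 fun hle => ?_
    have h1 := finrank_map_add_finrank_inf_ker ((range N).mkQ ∘ₗ M') Z
    have h2 := finrank_map_add_finrank_inf_ker N Z
    have h3 := finrank_map_add_finrank_inf_ker M (ker N)
    have h4 := finrank_map_add_finrank_inf_ker (range N).mkQ (ker φ)
    rw [Submodule.ker_mkQ, inf_eq_right.2 (show range N ≤ ker φ from hφN)] at h4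
    rw [show ker N ⊓ ker M = ⊥ from (Submodule.eq_bot_iff _).2 fun x hx => hMinj x hx.1 hx.2,
      finrank_bot] at h3
    rw [Submodule.map_comap_eq_of_le (show (ker N).map M ≤ range N from
        Submodule.map_le_iff_le_comap.2 hMN),
      inf_eq_right.2 (show ker N ≤ Z from fun x hx => by
        rw [Submodule.mem_comap, LinearMap.mem_ker.1 hx]
        exact Submodule.zero_mem _)] at h2
    have h5 : finrank K (Z.map ((range N).mkQ ∘ₗ M')) ≤
        finrank K ((ker φ).map (range N).mkQ) := by
      rw [Submodule.map_comp]
      refine Submodule.finrank_mono (Submodule.map_mono ?_)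
      rintro _ ⟨a, ha, rfl⟩
      exact hM'Z a ha
    have h6 := Submodule.finrank_mono hle
    omega
  have hMz : M' z ∈ range N := (Submodule.Quotient.mk_eq_zero _).1 hz.2
  obtain ⟨A, hA, hinj⟩ := ih.of_quotient N M' W (ker N) hrk.symm (hUV ▸ hrk.symm)
    (fun x hx => hx) (fun x hx h => hMinj x hx (by rwa [← hM'x x hx])) (by
      have : finrank K ↥(W ⊓ Submodule.compatibleMaps ((ker N).map M') (ker N)) ≤ finrank K W :=
        Submodule.finrank_mono inf_le_left
      omega) hzN (by rw [hmap]; exact hz.1) (Submodule.mem_sup_left hMz)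
  exact ⟨A, hA.trans (hM'.trans hM), hinj⟩

end BlockReduction

/-! ### The induction and the translation to matrices -/

theorem hasInvertibleLine (K : Type w) [Field K] (n : ℕ) : HasInvertibleLine.{u, v} K n := by
  induction n using Nat.strong_induction_on with
  | _ n ih =>
    intro U V _ _ _ _ _ _ hU hV N M₀ W x hWn hx hNx hM₀x
    obtain ⟨m, rfl⟩ : ∃ m, n = m + 1 := ⟨n - 1, by omega⟩
    by_cases hW : W = ⊥
    · subst hW
      obtain ⟨A, hA⟩ := exists_forall_injective_add_smul (m + 1) U V hU hV N x hx hNx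
      exact ⟨A, fun R hR => by simp [(Submodule.mem_bot K).1 hR], hA⟩
    have hW0 : finrank K W ≠ 0 := by rwa [Ne, Submodule.finrank_eq_zero]
    have hrk := LinearMap.finrank_range_add_finrank_ker N
    by_cases hk : 2 ≤ finrank K (ker N)
    · by_cases hI : ∃ M x u, TraceAgree W M M₀ ∧ x ∈ ker N ∧ u ∈ ker N ∧ u ≠ 0 ∧ M u ∈ range N ∧
          M x ∉ range N
      · obtain ⟨M₁, x₁, u₁, hM₁, hx₁, hu₁, hu₁0, hMu₁, hMx₁⟩ := hI
        obtain ⟨M, x, u, hM, hx, hu, hu0, hMu, hMx, hgood⟩ :=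
          exists_reducible_operator (hU.trans hV.symm) hk hW hx₁ hu₁ hu₁0 hMu₁ hMx₁
        obtain ⟨A, hA, hinj⟩ := (ih m (by omega)).of_vector N M W hU hV hx
          (fun h => hMx (by rw [h]; exact Submodule.zero_mem _)) hWn (Or.inr hgood) (z := u)
          (by
            rintro h
            obtain ⟨a, rfl⟩ := Submodule.mem_span_singleton.1 h
            have ha : a ≠ 0 := fun h => hu0 (by rw [h, zero_smul])
            rw [map_smul, Submodule.smul_mem_iff _ ha] at hMu
            exact hMx hMu)
          (by rw [LinearMap.mem_ker.1 hu]; exact Submodule.zero_mem _)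
          (Submodule.mem_sup_left hMu)
        exact ⟨A, hA.trans (hM.trans hM₁), hinj⟩
      · push Not at hI
        have hd := le_finrank_inf_rangeKer (hU.trans hV.symm) (N := N) (M₀ := M₀) (W := W) hNx hx
          hM₀x fun M hM hMx y hy => hI M y x hM hy hNx hx hMx
        refine (ih _ (by omega)).of_induced_eq_zero (hU.trans hV.symm) (by omega) hk
          (fun y hy => hI M₀ y x (fun _ _ => rfl) hy hNx hx hM₀x) ?_
        -- From `k² ≤ d + k` to `2k ≤ d + 2`, by `(k - 1)(k - 2) ≥ 0`.
        nlinarith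
    · have hker : ker N = Submodule.span K {x} := by
        refine (Submodule.eq_of_le_of_finrank_le
          ((Submodule.span_singleton_le_iff_mem _ _).2 hNx) ?_).symm
        rw [finrank_span_singleton hx]
        omega
      exact (ih m (by omega)).of_corank_one (by omega) hU hV (by omega) hx hker hM₀x

theorem mainTheorem3 {K : Type*} [Field K] (n : ℕ)
    (N : Matrix (Fin n) (Fin n) K) (hN : ¬ IsUnit N)
    (S : AffineSubspace K (Matrix (Fin n) (Fin n) K))
    (hS : (affineCodim S : ℤ) ≤ (n : ℤ) - 2)
    (hM : ∃ M ∈ S, ¬ Function.Injective (inducedOperator N M)) :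
    ∃ A ∈ S, ∀ t : K, IsUnit (A + t • N) := by
  obtain ⟨M, hMS, hM⟩ := hM
  rw [injective_iff_map_eq_zero] at hM
  push Not at hM
  obtain ⟨⟨x, hNx⟩, hMx, hx0⟩ := hM
  replace hMx : M.mulVecLin x ∈ range N.mulVecLin := (Submodule.Quotient.mk_eq_zero _).1 hMx
  have hD : finrank K (((Fin n → K) →ₗ[K] (Fin n → K)) ⧸ S.direction.map
      (Matrix.toLin' : _ ≃ₗ[K] ((Fin n → K) →ₗ[K] (Fin n → K))).toLinearMap) = affineCodim S :=
    (Submodule.Quotient.equiv S.direction _ Matrix.toLin' rfl).finrank_eq.symm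
  obtain ⟨W, hW, hWD⟩ := exists_submodule_trace_conditions (S.direction.map
    (Matrix.toLin' : _ ≃ₗ[K] ((Fin n → K) →ₗ[K] (Fin n → K))).toLinearMap)
  obtain ⟨A, hA, hinj⟩ := hasInvertibleLine K n (Fin n → K) (Fin n → K) (by simp) (by simp)
    N.mulVecLin M.mulVecLin W x (by omega) (fun h => hx0 (by simp [h])) hNx hMx
  obtain ⟨P, hP, hPA⟩ := hWD _ (traceAgree_iff_sub.1 hA)
  have hPA' : A = (P + M).mulVecLin := by
    rw [Matrix.mulVecLin_add, ← sub_eq_iff_eq_add, ← hPA]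
    rfl
  refine ⟨P + M, AffineSubspace.vadd_mem_of_mem_direction hP hMS, fun t => ?_⟩
  rw [← Matrix.mulVec_injective_iff_isUnit]
  have h := hinj t
  rw [hPA'] at h
  convert h using 1
  ext1 y
  simp [Matrix.add_mulVec, Matrix.smul_mulVec]
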